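/- Let $G=PSL(2,\mathbb R)=SL(2,\mathbb R)/\{\pm I\}$ with its usual topology, and let $\mathbb P^1$ be the projective line of lines through the origin in $\mathbb R^2$, with the $G$-action induced by the linear action on $\mathbb R^2$. For a compact metrizable space $X$, let $M(X)$ be the space of Borel probability measures on $X$ with the weak$^*$ topology inherited from $C(X)^*$; a continuous action of $G$ on $X$ induces an action on $M(X)$ by push-forward. A *dynamical $G$-system* is a nonempty compact metrizable space $X$ with a jointly continuous $G$-action. It is *minimal* if all its orbits are dense, and *strongly proximal* if for every $\mu\in M(X)$ there are a sequence $g_n\in G$ and a point $x\in X$ with $g_n\mu\to\delta_x$. A *universal minimal strongly proximal* $G$-system, denoted $\Pi_s(G)$, is a minimal strongly proximal $G$-system which has every minimal strongly proximal $G$-system as a factor, that is, as its image under a continuous $G$-equivariant surjection. An *affine $G$-system* is a nonempty compact convex metrizable subset $Q$ of a (Hausdorff, real) locally convex topological vector space with a jointly continuous action of $G$ on $Q$ by affine maps. It is *nontrivial* if it has more than one point, and *irreducible* if the only nonempty closed convex $G$-invariant subset of $Q$ is $Q$ itself. Two affine $G$-systems are *isomorphic* if there is a $G$-equivariant affine homeomorphism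 between them. **Corollary.** 1. $\mathbb P^1$ is a universal minimal strongly proximal $G$-system, and it is the only one up to isomorphism: every universal minimal strongly proximal $G$-system $X$ is $G$-equivariantly homeomorphic to $\mathbb P^1$, and $M(X)$ and $M(\mathbb P^1)$ are isomorphic affine $G$-systems. That is, $\Pi_s(G)=\mathbb P^1$ and $M(\Pi_s(G))=M(\mathbb P^1)$. 2. $M(\mathbb P^1)$ is a nontrivial irreducible affine $G$-system. 3. Every nontrivial irreducible affine $G$-system is isomorphic to $M(\mathbb P^1)$. -/

import Mathlib

open Topology Filter MeasureTheory
open scoped LinearAlgebra.Projectivization MatrixGroups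

universe u v w

namespace AffineDynamics

section ProbabilityMeasures

/-- `M(X)`: the probability measures on `X`, regarded as linear functionals on `C(X, ℝ)`
(by integration) and given the weak-* topology. -/
def probMeasures (X : Type*) [TopologicalSpace X] [MeasurableSpace X] [BorelSpace X] :
    Set (WeakDual ℝ C(X, ℝ)) :=
  {φ | ∃ μ : ProbabilityMeasure X, ∀ f : C(X, ℝ), φ f = ∫ x, f x ∂(μ : Measure X)}

variable {G X : Type*} [Group G] [TopologicalSpace X] [MeasurableSpace X] [BorelSpace X]
  [MulAction G X] [ContinuousConstSMul G X]

/-- The operator `f ↦ f ∘ g` on `C(X, ℝ)`. -/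
def precompSMul (X : Type*) [TopologicalSpace X] [MulAction G X] [ContinuousConstSMul G X] (g : G) :
    C(X, ℝ) →L[ℝ] C(X, ℝ) where
  toFun f := f.comp ⟨fun x => g • x, continuous_const_smul g⟩
  map_add' _ _ := rfl
  map_smul' _ _ := rfl
  cont := ContinuousMap.continuous_precomp _

lemma comp_precompSMul_mem (g : G) {φ : WeakDual ℝ C(X, ℝ)} (hφ : φ ∈ probMeasures X) :
    (ContinuousLinearMap.comp φ (precompSMul X g) : WeakDual ℝ C(X, ℝ)) ∈ probMeasures X := by
  obtain ⟨μ, hμ⟩ := hφ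
  have hg : Measurable (fun x : X => g • x) := (continuous_const_smul g).measurable
  refine ⟨μ.map hg.aemeasurable, fun f => ?_⟩
  rw [ProbabilityMeasure.toMeasure_map,
    integral_map hg.aemeasurable f.continuous.measurable.aestronglyMeasurable]
  exact hμ (precompSMul X g f)

/-- The induced action on `M(X)`, i.e. push-forward of measures: `(g • φ)(f) = φ(f ∘ g)`. -/
instance : MulAction G (probMeasures X) where
  smul g φ := ⟨ContinuousLinearMap.comp φ.1 (precompSMul X g), comp_precompSMul_mem g φ.2⟩
  one_smul φ := by
    refine Subtype.ext (ContinuousLinearMap.ext fun f => ?_)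
    change φ.1 (precompSMul X (1 : G) f) = φ.1 f
    congr 1
    ext x
    change f ((1 : G) • x) = f x
    rw [one_smul]
  mul_smul g h φ := by
    refine Subtype.ext (ContinuousLinearMap.ext fun f => ?_)
    change φ.1 (precompSMul X (g * h) f) = φ.1 (precompSMul X h (precompSMul X g f))
    congr 1
    ext x
    change f ((g * h) • x) = f (g • h • x)
    rw [mul_smul]

/-- The point mass at `x`, i.e. the functional `f ↦ f x`. -/
def pointMass (x : X) : probMeasures X :=
  ⟨(ContinuousMap.evalCLM ℝ x : C(X, ℝ) →L[ℝ] ℝ),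
    ⟨⟨Measure.dirac x, inferInstance⟩, fun f =>
      (integral_dirac' (f : X → ℝ) x f.continuous.measurable.stronglyMeasurable).symm⟩⟩

end ProbabilityMeasures

section Systems

/-- `X` is a minimal and strongly proximal dynamical system: a nonempty compact metrizable space
with a (jointly) continuous action of `G`, all of whose orbits are dense, such that every
probability measure has translates converging to a point mass. -/
structure IsMinimalStronglyProximal (G X : Type*) [Group G] [TopologicalSpace G]
    [TopologicalSpace X] [MeasurableSpace X] [BorelSpace X]
    [MulAction G X] [ContinuousSMul G X] : Prop where
  nonempty : Nonempty X
  compact : CompactSpace X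
  metrizable : TopologicalSpace.MetrizableSpace X
  minimal : MulAction.IsMinimal G X
  strongly_proximal : ∀ μ : probMeasures X, ∃ (g : ℕ → G) (x : X),
    Tendsto (fun n => g n • μ) atTop (𝓝 (pointMass x))

/-- `X` is a universal minimal strongly proximal `G`-system, `X = Π_s(G)`: it is minimal and
strongly proximal, and every minimal strongly proximal `G`-system `Y` is a factor of it. -/
def IsUniversalMinimalStronglyProximal.{a, b, c} (G : Type c) (X : Type a)
    [Group G] [TopologicalSpace G]
    [TopologicalSpace X] [MeasurableSpace X] [BorelSpace X]
    [MulAction G X] [ContinuousSMul G X] : Prop :=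
  IsMinimalStronglyProximal G X ∧
    ∀ (Y : Type b) [TopologicalSpace Y] [MeasurableSpace Y] [BorelSpace Y]
      [MulAction G Y] [ContinuousSMul G Y], IsMinimalStronglyProximal G Y →
      ∃ π : X → Y, Continuous π ∧ Function.Surjective π ∧ ∀ (g : G) (x : X), π (g • x) = g • π x

variable {E F : Type*} [AddCommGroup E] [Module ℝ E] [TopologicalSpace E]
  [AddCommGroup F] [Module ℝ F] [TopologicalSpace F]

/-- The map `T : Q → P` between subsets of vector spaces preserves convex combinations. -/
def IsAffineOn {E F : Type*} [AddCommGroup E] [Module ℝ E] [AddCommGroup F] [Module ℝ F]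
    {Q : Set E} {P : Set F} (T : Q → P) : Prop :=
  ∀ (x y z : Q) (a b : ℝ), 0 ≤ a → 0 ≤ b → a + b = 1 →
    (z : E) = a • (x : E) + b • (y : E) → (T z : F) = a • (T x : F) + b • (T y : F)

/-- `(Q, G)` is an affine dynamical system: `Q` is a nonempty compact convex metrizable subset of
the (locally convex) space `E`, and `G` acts (jointly) continuously on `Q` by affine maps. -/
structure IsAffineSystem (G : Type*) [Group G] [TopologicalSpace G]
    (Q : Set E) [MulAction G Q] : Prop where
  nonempty : Q.Nonempty
  compact : IsCompact Q
  convex : Convex ℝ Q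
  metrizable : TopologicalSpace.MetrizableSpace Q
  continuous_smul : ContinuousSMul G Q
  affine : ∀ g : G, IsAffineOn (fun x : Q => g • x)

/-- `(Q, G)` contains no proper affine subsystem. -/
def IsIrreducible (G : Type*) [Group G] (Q : Set E) [MulAction G Q] : Prop :=
  ∀ S : Set Q, S.Nonempty → IsClosed S → Convex ℝ (Subtype.val '' S : Set E) →
    (∀ (g : G), ∀ x ∈ S, g • x ∈ S) → S = Set.univ

/-- `(Q, G)` and `(P, G)` are isomorphic: there is a `G`-equivariant affine homeomorphism. -/
def AffinelyIsomorphic (G : Type*) [Group G] (Q : Set E) [MulAction G Q]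
    (P : Set F) [MulAction G P] : Prop :=
  ∃ Φ : Q ≃ₜ P, (∀ (g : G) (x : Q), Φ (g • x) = g • Φ x) ∧ IsAffineOn Φ

end Systems

section ProjectiveLine

/-- The projective line: the lines through the origin in `ℝ²`. `PSL(2, ℝ)` acts on it through
its linear action on `ℝ²`, by Mathlib's instance. -/
abbrev ProjLine : Type := ℙ ℝ (Fin 2 → ℝ)

/-- The projection from the nonzero vectors to the projective line. -/
noncomputable def toProjLine (v : {v : Fin 2 → ℝ // v ≠ 0}) : ProjLine := Projectivization.mk ℝ v.1 v.2

/-- The quotient topology. -/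
noncomputable instance : TopologicalSpace ProjLine := TopologicalSpace.coinduced toProjLine inferInstance

noncomputable instance : MeasurableSpace ProjLine := borel ProjLine

instance : BorelSpace ProjLine := ⟨rfl⟩

lemma isOpenQuotientMap_toProjLine : IsOpenQuotientMap toProjLine := by
  have hq : IsQuotientMap toProjLine := ⟨⟨rfl⟩, fun p =>
    ⟨⟨p.rep, p.rep_nonzero⟩, p.mk_rep⟩⟩
  refine ⟨hq.surjective, hq.continuous, fun U hU => ?_⟩
  rw [← hq.isOpen_preimage]
  let s : ℝˣ → {v : Fin 2 → ℝ // v ≠ 0} → {v : Fin 2 → ℝ // v ≠ 0} :=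
    fun a v => ⟨a • v.1, (smul_ne_zero_iff_ne a).mpr v.2⟩
  have hs : ∀ a, Continuous (s a) := fun a =>
    (continuous_subtype_val.const_smul a).subtype_mk _
  have : toProjLine ⁻¹' (toProjLine '' U) = ⋃ a, s a ⁻¹' U := by
    ext v
    simp only [Set.mem_preimage, Set.mem_image, Set.mem_iUnion]
    constructor
    · rintro ⟨w, hw, h⟩
      obtain ⟨a, ha⟩ := (Projectivization.mk_eq_mk_iff ℝ _ _ w.2 v.2).mp h
      refine ⟨a, ?_⟩
      have : s a v = w := Subtype.ext ha
      rwa [this]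
    · rintro ⟨a, ha⟩
      exact ⟨_, ha, (Projectivization.mk_eq_mk_iff ℝ _ _ (s a v).2 v.2).mpr ⟨a, rfl⟩⟩
  rw [this]
  exact isOpen_iUnion fun a => hU.preimage (hs a)

instance : ContinuousSMul PSL(2, ℝ) ProjLine where
  continuous_smul := by
    have hG : IsOpenQuotientMap (QuotientGroup.mk : SL(2, ℝ) → PSL(2, ℝ)) :=
      QuotientGroup.isOpenQuotientMap_mk
    refine (hG.prodMap isOpenQuotientMap_toProjLine).isQuotientMap.continuous_iff.mpr ?_
    let m : SL(2, ℝ) × {v : Fin 2 → ℝ // v ≠ 0} → {v : Fin 2 → ℝ // v ≠ 0} :=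
      fun p => ⟨p.1 • p.2.1, (smul_ne_zero_iff_ne p.1).mpr p.2.2⟩
    have hm : Continuous m := by
      refine Continuous.subtype_mk ?_ _
      change Continuous fun p : SL(2, ℝ) × {v : Fin 2 → ℝ // v ≠ 0} =>
        (p.1 : Matrix (Fin 2) (Fin 2) ℝ).mulVec p.2.1
      exact (Continuous.matrix_mulVec (continuous_subtype_val.comp continuous_fst)
        (continuous_subtype_val.comp continuous_snd))
    exact isOpenQuotientMap_toProjLine.continuous.comp hm

end ProjectiveLine

end AffineDynamics

/-! Let B be the upper triangular group. It is the stabilizer of the line `horizontal`, and ℙ¹ is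
its compact homogeneous space, so a B-fixed point in any G-space yields an equivariant map from ℙ¹
(`exists_equivariant_of_fixed`). B is amenable, so every affine system has such a point
(`exists_fixed_upperTri`).

For Y minimal strongly proximal, this gives an equivariant map ℙ¹ → M(Y). Its image is compact and a
single orbit. Strong proximality puts a point mass in it, so the B-fixed measure is itself a point
mass, at a B-fixed point of Y, which gives ℙ¹ → Y (`exists_factor`). Since B fixes only one line, an
equivariant self-map of ℙ¹ is the identity, whence uniqueness.

For Q irreducible, take φ : ℙ¹ → Q and send a measure on ℙ¹ to the barycenter of its image. This map
M(ℙ¹) → Q is affine, continuous and equivariant, and onto by irreducibility. It is injective because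
the affine functions on Q, pulled back by φ, are dense in C(ℙ¹) (`dense_affineFunctions`). The
density rests on `submodule_eq_top`: a closed invariant subspace of C(ℙ¹) with a nonconstant element
is everything. On the circle, rotations isolate the Fourier modes, and the derivative of a
hyperbolic flow links each positive mode to its two neighbours. -/

namespace AffineDynamics

/-! ### Fixed points of one-parameter groups of affine maps -/

section FixedPoints

variable {G E : Type*} [Group G] [TopologicalSpace G] [AddCommGroup E] [Module ℝ E]
  [TopologicalSpace E] {Q : Set E} [MulAction G Q]

/-- An average of the first `2 ^ k` translates of `x` under the powers of `g`, which is moved by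
`g` by `2⁻ᵏ (g ^ 2ᵏ • x - x)` only. -/
lemma exists_almost_fixed (hQ : IsAffineSystem G Q) {S : Set Q}
    (hconv : Convex ℝ (Subtype.val '' S : Set E)) (k : ℕ) :
    ∀ g : G, (∀ x ∈ S, g • x ∈ S) → ∀ x ∈ S, ∃ y ∈ S,
      ((g • y : Q) : E) - (y : E) = ((2 : ℝ)⁻¹ ^ k) • (((g ^ 2 ^ k • x : Q) : E) - (x : E)) := by
  induction k with
  | zero => exact fun g _ x hx => ⟨x, hx, by simp⟩
  | succ k ih =>
    intro g hg x hx
    have hpow : ∀ n : ℕ, g ^ n • x ∈ S := fun n => by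
      induction n with
      | zero => simpa using hx
      | succ n ihn => rw [pow_succ', mul_smul]; exact hg _ ihn
    obtain ⟨y, hy, hyx⟩ := ih g hg x hx
    -- Starting the second average at `g ^ 2 ^ k • x` makes the two displacements telescope.
    obtain ⟨z, hz, hzx⟩ := ih g hg _ (hpow (2 ^ k))
    obtain ⟨w, hw, hwe⟩ := hconv ⟨y, hy, rfl⟩ ⟨z, hz, rfl⟩ (a := 2⁻¹) (b := 2⁻¹)
      (by norm_num) (by norm_num) (by norm_num)
    refine ⟨w, hw, ?_⟩
    have h := hQ.affine g y z w 2⁻¹ 2⁻¹ (by norm_num) (by norm_num) (by norm_num) hwe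
    have e : g ^ 2 ^ (k + 1) • x = g ^ 2 ^ k • g ^ 2 ^ k • x := by
      rw [← mul_smul, ← pow_add, pow_succ, mul_two]
    rw [← e] at hzx
    calc ((g • w : Q) : E) - (w : E)
        = (2 : ℝ)⁻¹ • (((g • y : Q) : E) - y) + (2 : ℝ)⁻¹ • (((g • z : Q) : E) - z) := by
          rw [h, hwe]; module
      _ = _ := by rw [hyx, hzx, pow_succ]; module

lemma IsAffineSystem.convex_fixed (hQ : IsAffineSystem G Q) {S : Set Q}
    (hconv : Convex ℝ (Subtype.val '' S : Set E)) (H : Set G) :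
    Convex ℝ (Subtype.val '' {x ∈ S | ∀ g ∈ H, g • x = x} : Set E) := by
  rintro _ ⟨x, ⟨hx, hx'⟩, rfl⟩ _ ⟨y, ⟨hy, hy'⟩, rfl⟩ a b ha hb hab
  obtain ⟨z, hz, hze⟩ := hconv ⟨x, hx, rfl⟩ ⟨y, hy, rfl⟩ ha hb hab
  refine ⟨z, ⟨hz, fun g hg => Subtype.ext ?_⟩, hze⟩
  have h := hQ.affine g x y z a b ha hb hab hze
  simp only [hx' g hg, hy' g hg] at h
  rw [h, hze]

variable [IsTopologicalAddGroup E] [ContinuousSMul ℝ E] [LocallyConvexSpace ℝ E] [T2Space E]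

/-- Markov–Kakutani argument: a limit of almost fixed points is fixed, since a functional is bounded
on the compact `Q` and so sees displacements of size O(2⁻ᵏ). -/
lemma exists_fixed_of_invariant (hQ : IsAffineSystem G Q) {S : Set Q} (hne : S.Nonempty)
    (hcl : IsClosed S) (hconv : Convex ℝ (Subtype.val '' S : Set E)) (g : G)
    (hg : ∀ x ∈ S, g • x ∈ S) : ∃ x ∈ S, g • x = x := by
  have := hQ.metrizable
  have := hQ.continuous_smul
  have : CompactSpace Q := isCompact_iff_compactSpace.mp hQ.compact
  obtain ⟨x, hx⟩ := hne
  choose y hyS hy using fun k => exists_almost_fixed hQ hconv k g hg x hx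
  obtain ⟨z, φ, hφ, hz⟩ := CompactSpace.tendsto_subseq y
  refine ⟨z, hcl.mem_of_tendsto hz (Eventually.of_forall fun n => hyS _), ?_⟩
  by_contra hne
  obtain ⟨l, hl⟩ := geometric_hahn_banach_point_point (E := E) (x := ((g • z : Q) : E))
    (y := (z : E)) (fun h => hne (Subtype.ext h))
  obtain ⟨C, hC⟩ := hQ.compact.exists_bound_of_continuousOn l.continuous.continuousOn
  have h1 : Tendsto (fun n => l ((g • y (φ n) : Q) : E) - l (y (φ n) : E)) atTop
      (𝓝 (l ((g • z : Q) : E) - l (z : E))) := by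
    refine Tendsto.sub ?_ ?_
    · exact ((l.continuous.comp continuous_subtype_val).tendsto _).comp (hz.const_smul g)
    · exact ((l.continuous.comp continuous_subtype_val).tendsto _).comp hz
  have h2 : Tendsto (fun n => l ((g • y (φ n) : Q) : E) - l (y (φ n) : E)) atTop (𝓝 0) := by
    have h3 : Tendsto (fun n => (2 : ℝ)⁻¹ ^ (φ n) * (C + C)) atTop (𝓝 0) := by
      simpa using ((tendsto_pow_atTop_nhds_zero_of_lt_one (r := (2 : ℝ)⁻¹) (by norm_num)
        (by norm_num)).comp hφ.tendsto_atTop).mul_const (C + C)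
    refine squeeze_zero_norm (fun n => ?_) h3
    rw [← map_sub, hy, map_smul, norm_smul, norm_pow, norm_inv, Real.norm_ofNat, map_sub]
    gcongr
    exact (norm_sub_le _ _).trans (add_le_add (hC _ (Subtype.prop _)) (hC _ (Subtype.prop _)))
  have := tendsto_nhds_unique h1 h2
  linarith

/-- A one-parameter group of affine maps which preserves a nonempty closed convex set has a
fixed point in it. -/
lemma exists_fixed_of_oneParam (hQ : IsAffineSystem G Q) {S : Set Q} (hne : S.Nonempty)
    (hcl : IsClosed S) (hconv : Convex ℝ (Subtype.val '' S : Set E)) (γ : ℝ → G)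
    (hγ : Continuous γ) (hadd : ∀ s t, γ (s + t) = γ s * γ t)
    (hS : ∀ t, ∀ x ∈ S, γ t • x ∈ S) : ∃ x ∈ S, ∀ t, γ t • x = x := by
  have := hQ.metrizable
  have := hQ.continuous_smul
  have : CompactSpace Q := isCompact_iff_compactSpace.mp hQ.compact
  have h0 : γ 0 = 1 := by simpa using hadd 0 0
  have hnat : ∀ (x : Q) (s : ℝ), γ s • x = x → ∀ n : ℕ, γ (n * s) • x = x := fun x s h n => by
    induction n with
    | zero => simp [h0]
    | succ n ih => rw [Nat.cast_succ, add_mul, one_mul, hadd, mul_smul, h, ih]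
  -- These compact sets decrease, because γ(2⁻ᵏ) is the square of γ(2⁻ᵏ⁻¹). A common point is fixed
  -- at all dyadic times, hence at all times by continuity.
  let F : ℕ → Set Q := fun k => {x ∈ S | γ ((2 : ℝ)⁻¹ ^ k) • x = x}
  have hFc : ∀ k, IsClosed (F k) := fun k =>
    hcl.inter (isClosed_eq (continuous_const_smul _) continuous_id)
  obtain ⟨x, hx⟩ := IsCompact.nonempty_iInter_of_sequence_nonempty_isCompact_isClosed F
    (fun k x hx => ⟨hx.1, by
      have := hnat x _ hx.2 2
      rwa [pow_succ, Nat.cast_ofNat, mul_left_comm, mul_inv_cancel₀ two_ne_zero, mul_one] at this⟩)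
    (fun k => exists_fixed_of_invariant hQ hne hcl hconv _ (hS _)) (hFc 0).isCompact hFc
  rw [Set.mem_iInter] at hx
  refine ⟨x, (hx 0).1, fun t => ?_⟩
  have hneg : ∀ s, γ s • x = x → γ (-s) • x = x := fun s h => by
    conv_lhs => rw [← h, ← mul_smul, ← hadd, neg_add_cancel, h0, one_smul]
  have hcont : Continuous fun t => γ t • x := hγ.smul continuous_const
  have hpos : ∀ t, 0 ≤ t → γ t • x = x := fun t ht => by
    have h1 : Tendsto (fun k : ℕ => (⌊t * 2 ^ k⌋₊ : ℝ) * (2 : ℝ)⁻¹ ^ k) atTop (𝓝 t) := by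
      have h2 : Tendsto (fun k : ℕ => (⌊t * 2 ^ k⌋₊ : ℝ) / 2 ^ k) atTop (𝓝 t) :=
        (tendsto_nat_floor_mul_div_atTop (R := ℝ) ht).comp
          (tendsto_pow_atTop_atTop_of_one_lt (r := (2 : ℝ)) one_lt_two)
      simpa [div_eq_mul_inv] using h2
    have h3 := (hcont.tendsto t).comp h1
    refine tendsto_nhds_unique h3 ?_
    have : (fun t => γ t • x) ∘ (fun k : ℕ => (⌊t * 2 ^ k⌋₊ : ℝ) * (2 : ℝ)⁻¹ ^ k) = fun _ => x :=
      funext fun k => hnat x _ (hx k).2 _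
    rw [this]
    exact tendsto_const_nhds
  rcases le_total 0 t with ht | ht
  · exact hpos t ht
  · simpa using hneg _ (hpos (-t) (by linarith))

end FixedPoints

/-! ### The upper triangular group and its fixed points -/

section Borel

/-- The upper triangular matrices in `SL(2, ℝ)`. -/
noncomputable def upperTri (a : ℝ) (ha : a ≠ 0) (b : ℝ) : SL(2, ℝ) :=
  ⟨!![a, b; 0, a⁻¹], by simp [Matrix.det_fin_two, ha]⟩

lemma upperTri_mul {a b c d : ℝ} (ha : a ≠ 0) (hc : c ≠ 0) :
    upperTri a ha b * upperTri c hc d = upperTri (a * c) (mul_ne_zero ha hc) (a * d + b * c⁻¹) := by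
  refine Subtype.ext ?_
  change !![a, b; 0, a⁻¹] * !![c, d; 0, c⁻¹] = !![a * c, a * d + b * c⁻¹; 0, (a * c)⁻¹]
  rw [Matrix.mul_fin_two, mul_inv]
  simp

lemma upperTri_congr {a b c d : ℝ} (ha : a ≠ 0) (hc : c ≠ 0) (h : a = c) (h' : b = d) :
    upperTri a ha b = upperTri c hc d := by
  subst h h'
  rfl

lemma continuous_mk_SL {X : Type*} [TopologicalSpace X] (f : X → Matrix (Fin 2) (Fin 2) ℝ)
    (hf : Continuous f) (hdet : ∀ x, (f x).det = 1) :
    Continuous fun x => (QuotientGroup.mk (⟨f x, hdet x⟩ : SL(2, ℝ)) : PSL(2, ℝ)) :=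
  QuotientGroup.isOpenQuotientMap_mk.continuous.comp (hf.subtype_mk _)

lemma mk_neg_one : (((-1 : SL(2, ℝ))) : PSL(2, ℝ)) = 1 := by
  rw [QuotientGroup.eq_one_iff]
  exact Subgroup.mem_center_iff.mpr fun g => by simp

variable {E : Type*} [AddCommGroup E] [Module ℝ E] [TopologicalSpace E]
  [IsTopologicalAddGroup E] [ContinuousSMul ℝ E] [LocallyConvexSpace ℝ E] [T2Space E]
  {Q : Set E} [MulAction PSL(2, ℝ) Q]

/-- The (amenable) group of upper triangular matrices fixes a point of every affine system. -/
theorem exists_fixed_upperTri (hQ : IsAffineSystem PSL(2, ℝ) Q) :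
    ∃ x : Q, ∀ a ha b, ((upperTri a ha b : SL(2, ℝ)) : PSL(2, ℝ)) • x = x := by
  have := hQ.metrizable
  have := hQ.continuous_smul
  have hQne : Nonempty Q := hQ.nonempty.to_subtype
  let n : ℝ → PSL(2, ℝ) := fun t => (upperTri 1 one_ne_zero t : SL(2, ℝ))
  let d : ℝ → PSL(2, ℝ) := fun t => (upperTri (Real.exp t) (Real.exp_ne_zero t) 0 : SL(2, ℝ))
  have hn : Continuous n := continuous_mk_SL (fun t => !![1, t; 0, 1⁻¹]) (by
    refine continuous_matrix fun i j => ?_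
    fin_cases i <;> fin_cases j <;> simp <;> fun_prop) _
  have hd : Continuous d := continuous_mk_SL
    (fun t => !![Real.exp t, 0; 0, (Real.exp t)⁻¹]) (by
    refine continuous_matrix fun i j => ?_
    fin_cases i <;> fin_cases j <;> simp [← Real.exp_neg] <;> fun_prop) _
  have hnadd : ∀ s t, n (s + t) = n s * n t := fun s t => by
    change ((_ : SL(2, ℝ)) : PSL(2, ℝ)) = ((_ * _ : SL(2, ℝ)) : PSL(2, ℝ))
    congr 1
    rw [upperTri_mul]
    exact upperTri_congr _ _ (by simp) (by simp [add_comm])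
  have hdadd : ∀ s t, d (s + t) = d s * d t := fun s t => by
    change ((_ : SL(2, ℝ)) : PSL(2, ℝ)) = ((_ * _ : SL(2, ℝ)) : PSL(2, ℝ))
    congr 1
    rw [upperTri_mul]
    exact upperTri_congr _ _ (Real.exp_add s t) (by simp)
  -- The diagonal group normalizes the unipotent one, so it preserves the closed convex set of
  -- unipotent-fixed points and has a fixed point there.
  have hcomm : ∀ s t, n s * d t = d t * n (Real.exp (-t) * Real.exp (-t) * s) := fun s t => by
    change ((_ * _ : SL(2, ℝ)) : PSL(2, ℝ)) = ((_ * _ : SL(2, ℝ)) : PSL(2, ℝ))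
    congr 1
    rw [upperTri_mul, upperTri_mul]
    refine upperTri_congr _ _ (by simp) ?_
    rw [Real.exp_neg]
    field_simp
    ring
  obtain ⟨x₀, -, hx₀⟩ := exists_fixed_of_oneParam hQ (S := Set.univ) Set.univ_nonempty
    isClosed_univ (by simpa using hQ.convex) n hn hnadd (by simp)
  obtain ⟨x, hx, hxd⟩ := exists_fixed_of_oneParam hQ
    (S := {x ∈ Set.univ | ∀ g ∈ Set.range n, g • x = x}) ⟨x₀, by simpa using hx₀⟩
    (by
      simp only [Set.mem_univ, true_and, Set.ofPred_forall]
      exact isClosed_iInter fun g => isClosed_iInter fun _ =>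
        isClosed_eq (continuous_const_smul _) continuous_id)
    (hQ.convex_fixed (by simpa using hQ.convex) _) d hd hdadd
    (by
      simp only [Set.mem_univ, true_and, Set.forall_mem_range, Set.mem_ofPred_eq]
      intro t x hx s
      rw [← mul_smul, hcomm, mul_smul, hx])
  have hxn : ∀ s, n s • x = x := fun s => hx.2 _ ⟨s, rfl⟩
  have hpos : ∀ a (ha : 0 < a) b,
      ((upperTri a ha.ne' b : SL(2, ℝ)) : PSL(2, ℝ)) • x = x := fun a ha b => by
    have : ((upperTri a ha.ne' b : SL(2, ℝ)) : PSL(2, ℝ)) = d (Real.log a) * n (b / a) := by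
      change ((_ : SL(2, ℝ)) : PSL(2, ℝ)) = ((_ * _ : SL(2, ℝ)) : PSL(2, ℝ))
      congr 1
      rw [upperTri_mul]
      refine upperTri_congr _ _ (by simp [Real.exp_log ha]) ?_
      rw [Real.exp_log ha]
      field_simp
      ring
    rw [this, mul_smul, hxn, hxd]
  refine ⟨x, fun a ha b => ?_⟩
  -- A negative diagonal entry is made positive by -1, which is trivial in `PSL(2, ℝ)`.
  rcases lt_or_gt_of_ne ha with h | h
  · have h' : 0 < -a := by linarith
    have : ((upperTri a ha b : SL(2, ℝ)) : PSL(2, ℝ)) =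
        (((-1 : SL(2, ℝ))) : PSL(2, ℝ)) * (upperTri (-a) h'.ne' (-b) : SL(2, ℝ)) := by
      change ((_ : SL(2, ℝ)) : PSL(2, ℝ)) = ((_ * _ : SL(2, ℝ)) : PSL(2, ℝ))
      congr 1
      refine Subtype.ext ?_
      change !![a, b; 0, a⁻¹] = -1 * !![-a, -b; 0, (-a)⁻¹]
      rw [neg_one_mul]
      ext i j
      fin_cases i <;> fin_cases j <;> simp [inv_neg]
    rw [this, mk_neg_one, one_mul, hpos _ h']
  · exact hpos a h b

end Borel

/-! ### M(X) as an affine system -/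

section MeasureSpace

/-- Currying of (g, x) ↦ f (g • x). For compact `X` this is continuity in the sup norm, which makes
the action on M(X) jointly continuous. -/
lemma continuous_precompSMul {G X : Type*} [Group G] [TopologicalSpace G] [TopologicalSpace X]
    [MulAction G X] [ContinuousSMul G X] (f : C(X, ℝ)) :
    Continuous fun g : G => precompSMul X g f := by
  let F : C(G × X, ℝ) := ⟨fun p => f (p.1 • p.2), f.continuous.comp continuous_smul⟩
  exact F.curry.continuous

variable {G X : Type*} [TopologicalSpace X] [MeasurableSpace X] [BorelSpace X]

instance (V : Type*) [NormedAddCommGroup V] [NormedSpace ℝ V] :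
    LocallyConvexSpace ℝ (WeakDual ℝ V) :=
  inferInstanceAs (LocallyConvexSpace ℝ (WeakBilin (topDualPairing ℝ V)))

@[simp] lemma pointMass_apply (x : X) (f : C(X, ℝ)) :
    (pointMass x : WeakDual ℝ C(X, ℝ)) f = f x := rfl

lemma convex_probMeasures [CompactSpace X] : Convex ℝ (probMeasures X) := by
  rintro φ ⟨μ, hμ⟩ ψ ⟨ν, hν⟩ a b ha hb hab
  have hint : ∀ (ρ : ProbabilityMeasure X) (f : C(X, ℝ)),
      Integrable (fun x => f x) (ρ : Measure X) := fun ρ f =>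
    f.continuous.integrable_of_hasCompactSupport (HasCompactSupport.of_compactSpace _)
  refine ⟨⟨ENNReal.ofReal a • (μ : Measure X) + ENNReal.ofReal b • (ν : Measure X), ⟨?_⟩⟩,
    fun f => ?_⟩
  · simp [← ENNReal.ofReal_add ha hb, hab]
  · rw [ProbabilityMeasure.coe_mk, integral_add_measure, integral_smul_measure,
      integral_smul_measure, ENNReal.toReal_ofReal ha, ENNReal.toReal_ofReal hb, ← hμ, ← hν]
    · rfl
    · exact (hint μ f).smul_measure ENNReal.ofReal_ne_top
    · exact (hint ν f).smul_measure ENNReal.ofReal_ne_top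

lemma isCompact_probMeasures [CompactSpace X] [T2Space X] : IsCompact (probMeasures X) := by
  have hint : ∀ (ρ : ProbabilityMeasure X) (f : C(X, ℝ)),
      Integrable (fun x => f x) (ρ : Measure X) := fun ρ f =>
    f.continuous.integrable_of_hasCompactSupport (HasCompactSupport.of_compactSpace _)
  let I : ProbabilityMeasure X → WeakDual ℝ C(X, ℝ) := fun μ =>
    (LinearMap.mkContinuous
      { toFun := fun f : C(X, ℝ) => ∫ x, f x ∂(μ : Measure X)
        map_add' := fun f g => integral_add (hint μ f) (hint μ g)
        map_smul' := fun c f => integral_const_mul c _ } 1 fun f => by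
      simpa using norm_integral_le_of_norm_le_const (μ := (μ : Measure X))
        (Eventually.of_forall fun x => f.norm_coe_le_norm x) : C(X, ℝ) →L[ℝ] ℝ)
  have hI : Continuous I := by
    refine WeakDual.continuous_of_continuous_eval fun f => ?_
    exact ProbabilityMeasure.continuous_integral_boundedContinuousFunction
      (BoundedContinuousFunction.mkOfCompact f)
  convert isCompact_range hI using 1
  ext φ
  constructor
  · rintro ⟨μ, hμ⟩
    exact ⟨μ, ContinuousLinearMap.ext fun f => (hμ f).symm⟩
  · rintro ⟨μ, rfl⟩
    exact ⟨μ, fun f => rfl⟩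

lemma abs_apply_le_norm [CompactSpace X] (φ : probMeasures X) (f : C(X, ℝ)) :
    |(φ : WeakDual ℝ C(X, ℝ)) f| ≤ ‖f‖ := by
  obtain ⟨_, μ, hμ⟩ := φ
  rw [hμ f]
  simpa using norm_integral_le_of_norm_le_const (μ := (μ : Measure X))
        (Eventually.of_forall fun x => f.norm_coe_le_norm x)

variable [Group G] [TopologicalSpace G] [MulAction G X] [ContinuousSMul G X]

lemma smul_apply (g : G) (φ : probMeasures X) (f : C(X, ℝ)) :
    ((g • φ : probMeasures X) : WeakDual ℝ C(X, ℝ)) f =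
      (φ : WeakDual ℝ C(X, ℝ)) (precompSMul X g f) := rfl

lemma smul_pointMass (g : G) (x : X) : g • pointMass x = pointMass (g • x) := rfl

theorem isAffineSystem_probMeasures [CompactSpace X] [TopologicalSpace.MetrizableSpace X]
    [Nonempty X] : IsAffineSystem G (probMeasures X) where
  nonempty := ⟨_, (pointMass (Classical.arbitrary X)).2⟩
  compact := isCompact_probMeasures
  convex := convex_probMeasures
  metrizable := by
    have : SecondCountableTopology X := by
      let := TopologicalSpace.metrizableSpaceMetric X
      infer_instance
    exact WeakDual.metrizable_of_isCompact ℝ _ _ isCompact_probMeasures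
  continuous_smul := ⟨by
    refine Continuous.subtype_mk (WeakDual.continuous_of_continuous_eval fun f => ?_) _
    rw [continuous_iff_continuousAt]
    rintro ⟨g, φ⟩
    -- Functionals in M(X) have norm at most 1, so replacing the moving group element by `g` costs
    -- at most the sup-norm difference, uniformly in the measure.
    have h1 : Tendsto (fun p : G × probMeasures X =>
        (p.2 : WeakDual ℝ C(X, ℝ)) (precompSMul X p.1 f - precompSMul X g f)) (𝓝 (g, φ)) (𝓝 0) := by
      refine squeeze_zero_norm (fun p => abs_apply_le_norm _ _) ?_
      have : Continuous fun p : G × probMeasures X =>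
          ‖precompSMul X p.1 f - precompSMul X g f‖ :=
        (((continuous_precompSMul f).comp continuous_fst).sub continuous_const).norm
      simpa using this.tendsto (g, φ)
    have h2 : Tendsto (fun p : G × probMeasures X =>
        (p.2 : WeakDual ℝ C(X, ℝ)) (precompSMul X g f)) (𝓝 (g, φ))
        (𝓝 ((φ : WeakDual ℝ C(X, ℝ)) (precompSMul X g f))) :=
      ((WeakDual.eval_continuous _).comp (continuous_subtype_val.comp continuous_snd)).tendsto _
    have h3 := h1.add h2
    simp only [map_sub, sub_add_cancel, zero_add] at h3
    exact h3⟩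
  affine g φ ψ χ a b _ _ _ h := ContinuousLinearMap.ext fun f => by
    have := congrArg (fun θ : WeakDual ℝ C(X, ℝ) => θ (precompSMul X g f)) h
    exact this

/-- `M(X)` is the closed convex hull of the point masses. -/
theorem eq_univ_of_pointMass_mem [CompactSpace X] [T2Space X] {S : Set (probMeasures X)}
    (hcl : IsClosed S) (hconv : Convex ℝ (Subtype.val '' S : Set (WeakDual ℝ C(X, ℝ))))
    (hS : ∀ x, pointMass x ∈ S) : S = Set.univ := by
  refine Set.eq_univ_of_forall fun φ => ?_
  by_contra hφ
  have hcl' : IsClosed (Subtype.val '' S : Set (WeakDual ℝ C(X, ℝ))) :=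
    isCompact_probMeasures.isClosed.isClosedEmbedding_subtypeVal.isClosedMap _ hcl
  obtain ⟨l, u, hl, hu⟩ := geometric_hahn_banach_closed_point hconv hcl' (x := φ.1)
    (fun ⟨ψ, hψ, h⟩ => hφ (Subtype.ext h ▸ hψ))
  -- A weak-* continuous functional is evaluation at some `f`. The separation then says f < u at
  -- every point while ∫ f dμ > u.
  obtain ⟨f, hf⟩ := LinearMap.dualEmbedding_surjective (topDualPairing ℝ C(X, ℝ)) l
  have hlf : ∀ ψ : WeakDual ℝ C(X, ℝ), l ψ = ψ f := fun ψ => by rw [← hf]; rfl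
  obtain ⟨_, μ, hμ⟩ := φ
  rw [hlf, hμ] at hu
  have hint : Integrable (fun x => f x) (μ : Measure X) :=
    f.continuous.integrable_of_hasCompactSupport (HasCompactSupport.of_compactSpace _)
  have : ∫ x, f x ∂(μ : Measure X) ≤ ∫ x, u ∂(μ : Measure X) :=
    integral_mono hint (integrable_const _) fun x => by
      have := hl _ ⟨_, hS x, rfl⟩
      rw [hlf] at this
      exact this.le
  simp only [integral_const, probReal_univ, one_smul] at this
  linarith

end MeasureSpace

/-! ### Closed translation-invariant spaces of functions on the circle -/

section Fourier

variable {T : ℝ}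

/-- The translate of a function on the circle. -/
noncomputable def translate (f : C(AddCircle T, ℂ)) (a : AddCircle T) : C(AddCircle T, ℂ) :=
  f.comp ⟨fun x => x + a, continuous_add_const a⟩

@[simp] lemma translate_apply (f : C(AddCircle T, ℂ)) (a x : AddCircle T) :
    translate f a x = f (x + a) := rfl

lemma continuous_translate (f : C(AddCircle T, ℂ)) : Continuous (translate f) := by
  let F : C(AddCircle T × AddCircle T, ℂ) := ⟨fun p => f (p.2 + p.1), by fun_prop⟩
  exact F.curry.continuous

variable [hT : Fact (0 < T)]

/-- Projection to a Fourier mode as a `C(AddCircle T, ℂ)`-valued average of translates, so that it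
preserves closed translation-invariant subspaces. -/
lemma integral_translate (f : C(AddCircle T, ℂ)) (n : ℤ) :
    ∫ a, fourier (-n) a • translate f a ∂AddCircle.haarAddCircle =
      fourierCoeff f n • (fourier n : C(AddCircle T, ℂ)) := by
  have hint : Integrable (fun a => fourier (-n) a • translate f a)
      (AddCircle.haarAddCircle (T := T)) :=
    (((fourier (-n)).continuous.smul (continuous_translate f))).integrable_of_hasCompactSupport
      (HasCompactSupport.of_compactSpace _)
  ext x
  rw [ContinuousMap.integral_apply hint]
  have h := integral_add_left_eq_self (μ := AddCircle.haarAddCircle (T := T))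
    (fun a => fourier (-n) (a - x) * f a) x
  simp only [ContinuousMap.smul_apply, translate_apply, smul_eq_mul, fourierCoeff] at h ⊢
  simp only [add_sub_cancel_left] at h
  rw [h, ← integral_mul_const]
  refine integral_congr_ae (Eventually.of_forall fun a => ?_)
  have : (fourier (-n) (a - x) : ℂ) = fourier (-n) a * fourier n x := by
    simp [fourier_apply, sub_eq_add_neg, smul_add, AddCircle.toCircle_add]
  simp only [this]
  ring

variable {W : Submodule ℂ C(AddCircle T, ℂ)}

lemma fourierCoeff_smul_mem (hcl : IsClosed (W : Set C(AddCircle T, ℂ)))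
    (htr : ∀ f ∈ W, ∀ a, translate f a ∈ W) {f : C(AddCircle T, ℂ)} (hf : f ∈ W) (n : ℤ) :
    fourierCoeff f n • (fourier n : C(AddCircle T, ℂ)) ∈ W := by
  rw [← integral_translate]
  refine (W.restrictScalars ℝ).convex.integral_mem hcl
    (Eventually.of_forall fun a => W.smul_mem _ (htr f hf a)) ?_
  exact (((fourier (-n)).continuous.smul (continuous_translate f))).integrable_of_hasCompactSupport
      (HasCompactSupport.of_compactSpace _)

/-- Otherwise the Fourier series reduces to its constant term; being summable, it converges to `f`,
which is then constant. -/
lemma exists_fourierCoeff_ne_zero {f : C(AddCircle T, ℂ)} (hf : ∃ x y, f x ≠ f y) :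
    ∃ n ≠ 0, fourierCoeff f n ≠ 0 := by
  by_contra! h
  obtain ⟨x, y, hxy⟩ := hf
  have hs : HasSum (fun i => fourierCoeff f i • (fourier i : C(AddCircle T, ℂ)))
      (fourierCoeff f 0 • (fourier 0 : C(AddCircle T, ℂ))) :=
    hasSum_single 0 fun n hn => by rw [h n hn, zero_smul]
  have hf' := (hasSum_fourier_series_of_summable (f := f)
    (hasSum_single 0 fun n hn => h n hn).summable).unique hs
  refine hxy ?_
  rw [hf']
  simp

/-- The image of the coordinate `z = fourier 1` under `z ↦ (z + τ) / (1 + τ z)`. -/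
noncomputable def boost (τ : ℝ) : C(AddCircle T, ℂ) :=
  (fourier 1 + (τ : ℂ) • 1) * Ring.inverse (1 + (τ : ℂ) • fourier 1)

/-- At τ = 0 the boost has velocity 1 - z². Working in the Banach algebra with `Ring.inverse` gives
uniform convergence of the difference quotients. -/
lemma hasDerivAt_boost_pow (n : ℕ) :
    HasDerivAt (fun τ => (boost τ : C(AddCircle T, ℂ)) ^ (n + 1))
      (((n : ℂ) + 1) • (fourier n - fourier (n + 2))) 0 := by
  have hid : HasDerivAt (fun τ : ℝ => (τ : ℂ)) 1 0 := Complex.ofRealCLM.hasDerivAt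
  have h1 : HasDerivAt (fun τ : ℝ => (fourier 1 + (τ : ℂ) • 1 : C(AddCircle T, ℂ)))
      ((1 : ℂ) • 1) 0 := (hid.smul_const _).const_add _
  have h2 : HasDerivAt (fun τ : ℝ => (1 + (τ : ℂ) • fourier 1 : C(AddCircle T, ℂ)))
      ((1 : ℂ) • fourier 1) 0 := (hid.smul_const _).const_add _
  have h3 := (hasFDerivAt_ringInverse (𝕜 := ℝ) (1 : C(AddCircle T, ℂ)ˣ))
  have h4 := (h1.mul (h3.comp_hasDerivAt_of_eq 0 h2 (by simp))).pow (n + 1)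
  convert! h4 using 1
  have hp : ∀ m : ℕ, (fourier 1 : C(AddCircle T, ℂ)) ^ m = fourier m := fun m => by
    ext x
    simp [fourier_apply, AddCircle.toCircle_nsmul]
  rw [show (n : ℤ) + 2 = ((n + 2 : ℕ) : ℤ) by push_cast; rfl, ← hp, ← hp]
  ext x
  simp
  ring

/-- The derivative of the boosts of mode n + 1 stays in the closed space `W`. Both its modes, n and
n + 2, have nonzero coefficients, and each is extracted by projection. -/
lemma fourier_mem_succ (hcl : IsClosed (W : Set C(AddCircle T, ℂ)))
    (htr : ∀ f ∈ W, ∀ a, translate f a ∈ W)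
    (hb : ∀ n : ℕ, fourier n ∈ W → ∀ τ : ℝ, |τ| < 1 → boost τ ^ n ∈ W) {n : ℕ}
    (h : fourier ((n + 1 : ℕ) : ℤ) ∈ W) : fourier (n : ℤ) ∈ W ∧ fourier ((n : ℤ) + 2) ∈ W := by
  have hmem : (((n : ℂ) + 1) • (fourier n - fourier (n + 2)) : C(AddCircle T, ℂ)) ∈ W := by
    have h1 := (hasDerivAt_iff_tendsto_slope.mp (hasDerivAt_boost_pow (T := T) n))
    refine hcl.mem_of_tendsto h1 ?_
    have : ∀ᶠ τ in 𝓝[≠] (0 : ℝ), |τ| < 1 :=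
      nhdsWithin_le_nhds (by
        simpa [Metric.ball, Real.dist_eq] using Metric.ball_mem_nhds (0 : ℝ) one_pos)
    filter_upwards [this] with τ hτ
    have h2 := W.sub_mem (hb _ h τ hτ) (hb _ h 0 (by simp))
    exact (W.restrictScalars ℝ).smul_mem _ h2
  have hc : ∀ m, fourierCoeff (fun x => (((n : ℂ) + 1) • (fourier n - fourier (n + 2)) :
      C(AddCircle T, ℂ)) x) m = ((n : ℂ) + 1) * ((Pi.single (n : ℤ) 1 : ℤ → ℂ) m -
        (Pi.single (n + 2 : ℤ) 1 : ℤ → ℂ) m) := by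
    intro m
    have hint : ∀ f : C(AddCircle T, ℂ), Integrable f (AddCircle.haarAddCircle (T := T)) :=
      fun f => f.continuous.integrable_of_hasCompactSupport (HasCompactSupport.of_compactSpace _)
    have e : (fun x => (((n : ℂ) + 1) • (fourier n - fourier (n + 2)) : C(AddCircle T, ℂ)) x) =
        ((n : ℂ) + 1) • ((fourier n : C(AddCircle T, ℂ)) +
          (-1 : ℂ) • (fourier (n + 2) : C(AddCircle T, ℂ)) : AddCircle T → ℂ) := by
      ext x
      simp [sub_eq_add_neg]
      ring
    rw [e, Pi.smul_def]
    simp only [smul_eq_mul]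
    rw [fourierCoeff.const_mul, fourierCoeff.add (hint _) ((hint _).smul _)]
    simp only [Pi.add_apply, Pi.smul_def, smul_eq_mul]
    rw [fourierCoeff.const_mul, fourierCoeff_fourier, fourierCoeff_fourier]
    ring
  have h0 : (n : ℂ) + 1 ≠ 0 := by exact_mod_cast n.succ_ne_zero
  constructor
  · have := fourierCoeff_smul_mem hcl htr hmem n
    rw [hc] at this
    simpa [h0, W.smul_mem_iff] using this
  · have := fourierCoeff_smul_mem hcl htr hmem (n + 2)
    rw [hc] at this
    refine (W.smul_mem_iff (neg_ne_zero.mpr h0)).mp ?_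
    simpa using this

/-- A nonconstant element supplies a nonzero mode, made positive by conjugation. Descending to modes
1 and 0, climbing from 1 and conjugating reach all modes, whose span is dense. -/
theorem fourier_submodule_eq_top (hcl : IsClosed (W : Set C(AddCircle T, ℂ)))
    (htr : ∀ f ∈ W, ∀ a, translate f a ∈ W) (hstar : ∀ f ∈ W, star f ∈ W)
    (hb : ∀ n : ℕ, fourier n ∈ W → ∀ τ : ℝ, |τ| < 1 → boost τ ^ n ∈ W)
    (hne : ∃ f ∈ W, ∃ x y, f x ≠ f y) : W = ⊤ := by
  have hneg : ∀ n : ℤ, fourier n ∈ W → fourier (-n) ∈ W := fun n hn => by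
    convert! hstar _ hn using 1
    ext x
    simp
  have hnat : ∀ n : ℕ, fourier (n : ℤ) ∈ W := by
    have hex : ∃ n : ℕ, fourier ((n + 1 : ℕ) : ℤ) ∈ W := by
      obtain ⟨f, hf, hxy⟩ := hne
      obtain ⟨n, hn, hfn⟩ := exists_fourierCoeff_ne_zero hxy
      have h1 := (W.smul_mem_iff hfn).mp (fourierCoeff_smul_mem hcl htr hf n)
      obtain ⟨m, rfl | rfl⟩ := n.eq_nat_or_neg
      · obtain ⟨k, rfl⟩ := Nat.exists_eq_succ_of_ne_zero (n := m) (by simpa using hn)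
        exact ⟨k, h1⟩
      · obtain ⟨k, rfl⟩ := Nat.exists_eq_succ_of_ne_zero (n := m) (by simpa using hn)
        exact ⟨k, by simpa only [neg_neg] using hneg _ h1⟩
    have hdown : ∀ n : ℕ, fourier (n : ℤ) ∈ W → ∀ m ≤ n, fourier (m : ℤ) ∈ W := fun n => by
      induction n with
      | zero => intro h m hm; obtain rfl : m = 0 := by omega
                exact h
      | succ n ih =>
        intro h m hm
        rcases Nat.lt_or_ge n m with hm' | hm'
        · obtain rfl : m = n + 1 := by omega
          exact h
        · exact ih (fourier_mem_succ hcl htr hb h).1 m hm'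
    have h1 : fourier ((1 : ℕ) : ℤ) ∈ W := by
      obtain ⟨n, hn⟩ := hex
      exact hdown _ hn 1 (by omega)
    intro n
    induction n using Nat.twoStepInduction with
    | zero => exact hdown _ h1 0 (by omega)
    | one => exact h1
    | more n _ h => exact_mod_cast (fourier_mem_succ hcl htr hb h).2
  have hall : ∀ n : ℤ, fourier n ∈ W := fun n => by
    obtain ⟨m, rfl | rfl⟩ := n.eq_nat_or_neg
    exacts [hnat m, hneg _ (hnat m)]
  rw [eq_top_iff, ← span_fourier_closure_eq_top]
  exact Submodule.topologicalClosure_minimal _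
    (Submodule.span_le.mpr (Set.range_subset_iff.mpr hall)) hcl

end Fourier

/-! ### The projective line as a homogeneous space and as a circle -/

section ProjectiveLine

lemma smul_toProjLine (g : SL(2, ℝ)) (v : {v : Fin 2 → ℝ // v ≠ 0}) :
    (QuotientGroup.mk g : PSL(2, ℝ)) • toProjLine v =
      toProjLine ⟨g • v.1, (smul_ne_zero_iff_ne g).mpr v.2⟩ := rfl

lemma SL_smul_eq (g : SL(2, ℝ)) (v : Fin 2 → ℝ) :
    g • v = ![g 0 0 * v 0 + g 0 1 * v 1, g 1 0 * v 0 + g 1 1 * v 1] := by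
  change (g : Matrix (Fin 2) (Fin 2) ℝ).mulVec v = _
  ext i
  fin_cases i <;> simp [Matrix.mulVec, dotProduct, Fin.sum_univ_two]

lemma sq_add_sq_ne_zero (v : {v : Fin 2 → ℝ // v ≠ 0}) : v.1 0 ^ 2 + v.1 1 ^ 2 ≠ 0 := by
  intro h
  refine v.2 ?_
  have h0 : v.1 0 = 0 := by nlinarith [sq_nonneg (v.1 0), sq_nonneg (v.1 1)]
  have h1 : v.1 1 = 0 := by nlinarith [sq_nonneg (v.1 0), sq_nonneg (v.1 1)]
  ext i
  fin_cases i <;> simp [h0, h1]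

/-- The line `ℝ × 0`. -/
noncomputable def horizontal : ProjLine := toProjLine ⟨![1, 0], by simp⟩

/-- A matrix in `SL(2, ℝ)` with given first column. -/
noncomputable def frame (v : {v : Fin 2 → ℝ // v ≠ 0}) : SL(2, ℝ) :=
  ⟨!![v.1 0, -v.1 1 / (v.1 0 ^ 2 + v.1 1 ^ 2); v.1 1, v.1 0 / (v.1 0 ^ 2 + v.1 1 ^ 2)], by
    have := sq_add_sq_ne_zero v
    rw [Matrix.det_fin_two_of]
    field_simp
    ring⟩

lemma frame_smul (v : {v : Fin 2 → ℝ // v ≠ 0}) :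
    (QuotientGroup.mk (frame v) : PSL(2, ℝ)) • horizontal = toProjLine v := by
  rw [horizontal, smul_toProjLine]
  congr 1
  refine Subtype.ext ?_
  simp only [SL_smul_eq]
  ext i
  fin_cases i <;> simp [frame]

lemma exists_smul_horizontal (p : ProjLine) : ∃ g : PSL(2, ℝ), g • horizontal = p := by
  obtain ⟨v, rfl⟩ := isOpenQuotientMap_toProjLine.surjective p
  exact ⟨_, frame_smul v⟩

lemma toProjLine_eq_iff (v w : {v : Fin 2 → ℝ // v ≠ 0}) :
    toProjLine v = toProjLine w ↔ v.1 0 * w.1 1 = v.1 1 * w.1 0 := by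
  rw [toProjLine, toProjLine, Projectivization.mk_eq_mk_iff']
  constructor
  · rintro ⟨a, ha⟩
    rw [← ha]
    simp only [Pi.smul_apply, smul_eq_mul]
    ring
  · intro h
    have hw := sq_add_sq_ne_zero w
    -- The coefficient of the orthogonal projection of `v` to the line of `w`.
    refine ⟨(v.1 0 * w.1 0 + v.1 1 * w.1 1) / (w.1 0 ^ 2 + w.1 1 ^ 2), ?_⟩
    ext i
    fin_cases i
    · simp
      field_simp
      linear_combination (-w.1 1) * h
    · simp
      field_simp
      linear_combination w.1 0 * h

lemma exists_eq_upperTri {g : SL(2, ℝ)}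
    (hg : (QuotientGroup.mk g : PSL(2, ℝ)) • horizontal = horizontal) :
    ∃ a ha b, g = upperTri a ha b := by
  rw [horizontal, smul_toProjLine, toProjLine_eq_iff] at hg
  simp only [SL_smul_eq] at hg
  simp at hg
  have hdet := g.det_coe
  rw [Matrix.det_fin_two, ← hg] at hdet
  have h0 : g 0 0 ≠ 0 := fun h => by simp [h] at hdet
  refine ⟨g 0 0, h0, g 0 1, Subtype.ext ?_⟩
  have h1 : g 1 1 = (g 0 0)⁻¹ := by
    field_simp
    linarith
  ext i j
  fin_cases i <;> fin_cases j <;> simp [upperTri, h1, ← hg]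

lemma upperTri_smul_horizontal (a : ℝ) (ha : a ≠ 0) (b : ℝ) :
    (QuotientGroup.mk (upperTri a ha b) : PSL(2, ℝ)) • horizontal = horizontal := by
  rw [horizontal, smul_toProjLine, toProjLine_eq_iff]
  simp only [SL_smul_eq]
  simp [upperTri]

/-- The single shear (x, y) ↦ (x + y, y) already moves every other line. -/
lemma eq_horizontal_of_fixed {p : ProjLine}
    (hp : ∀ a ha b, (QuotientGroup.mk (upperTri a ha b) : PSL(2, ℝ)) • p = p) :
    p = horizontal := by
  obtain ⟨v, rfl⟩ := isOpenQuotientMap_toProjLine.surjective p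
  have := hp 1 one_ne_zero 1
  rw [smul_toProjLine, toProjLine_eq_iff] at this
  simp only [SL_smul_eq] at this
  rw [horizontal, toProjLine_eq_iff]
  simp [upperTri] at this ⊢
  nlinarith

/-- A point fixed by the upper triangular matrices gives rise to an equivariant map on the
projective line. -/
theorem exists_equivariant_of_fixed {Z : Type*} [TopologicalSpace Z] [MulAction PSL(2, ℝ) Z]
    [ContinuousSMul PSL(2, ℝ) Z] (z : Z)
    (hz : ∀ a ha b, (QuotientGroup.mk (upperTri a ha b) : PSL(2, ℝ)) • z = z) :
    ∃ φ : ProjLine → Z, Continuous φ ∧ (∀ (g : PSL(2, ℝ)) p, φ (g • p) = g • φ p) ∧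
      φ horizontal = z := by
  have hwd : ∀ g h : PSL(2, ℝ), g • horizontal = h • horizontal → g • z = h • z := by
    intro g h hgh
    obtain ⟨k, hk⟩ := QuotientGroup.mk_surjective (h⁻¹ * g)
    obtain ⟨a, ha, b, rfl⟩ := exists_eq_upperTri (g := k)
      (by rw [hk, mul_smul, hgh, inv_smul_smul])
    have := hz a ha b
    rwa [hk, mul_smul, inv_smul_eq_iff] at this
  choose s hs using exists_smul_horizontal
  refine ⟨fun p => s p • z, ?_, fun g p => ?_, ?_⟩
  -- The choice `s` need not be continuous, but `s p • z` depends only on `p`, so on nonzero vectors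
  -- it may be computed with the continuous `frame`.
  · refine isOpenQuotientMap_toProjLine.isQuotientMap.continuous_iff.mpr ?_
    have : (fun p => s p • z) ∘ toProjLine =
        fun v => (QuotientGroup.mk (frame v) : PSL(2, ℝ)) • z :=
      funext fun v => hwd _ _ (by rw [hs, frame_smul])
    rw [this]
    have hc : ∀ i, Continuous fun v : {v : Fin 2 → ℝ // v ≠ 0} => v.1 i := fun i =>
      (continuous_apply i).comp continuous_subtype_val
    have hd : Continuous fun v : {v : Fin 2 → ℝ // v ≠ 0} => v.1 0 ^ 2 + v.1 1 ^ 2 :=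
      ((hc 0).pow 2).add ((hc 1).pow 2)
    refine Continuous.smul ?_ continuous_const
    refine continuous_mk_SL (fun v : {v : Fin 2 → ℝ // v ≠ 0} =>
      !![v.1 0, -v.1 1 / (v.1 0 ^ 2 + v.1 1 ^ 2); v.1 1, v.1 0 / (v.1 0 ^ 2 + v.1 1 ^ 2)])
      (continuous_matrix fun i j => ?_) (fun v => (frame v).det_coe)
    fin_cases i <;> fin_cases j
    · exact hc 0
    · exact (hc 1).neg.div hd sq_add_sq_ne_zero
    · exact hc 1
    · exact (hc 0).div hd sq_add_sq_ne_zero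
  · rw [← mul_smul]
    exact hwd _ _ (by rw [hs, mul_smul, hs])
  · conv_rhs => rw [← one_smul PSL(2, ℝ) z]
    exact hwd _ _ (by rw [hs, one_smul])

/-- The coordinate `(x + iy) / (x - iy)` on the projective line. -/
noncomputable def circleCoord : ProjLine → ℂ :=
  Projectivization.lift (fun v : {v : Fin 2 → ℝ // v ≠ 0} =>
    ((v.1 0 : ℂ) + v.1 1 * Complex.I) / ((v.1 0 : ℂ) - v.1 1 * Complex.I)) (by
    intro v w t hvw
    have ht : (t : ℂ) ≠ 0 := by
      rintro h
      exact v.2 (by rw [hvw, Complex.ofReal_eq_zero.mp h, zero_smul])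
    simp only [hvw, Pi.smul_apply, smul_eq_mul, Complex.ofReal_mul]
    rw [mul_assoc, ← mul_add, ← mul_sub, mul_div_mul_left _ _ ht])

lemma coord_sub_ne_zero (v : {v : Fin 2 → ℝ // v ≠ 0}) :
    (v.1 0 : ℂ) - v.1 1 * Complex.I ≠ 0 := by
  intro h
  have h0 := congrArg Complex.re h
  have h1 := congrArg Complex.im h
  simp at h0 h1
  exact sq_add_sq_ne_zero v (by simp [h0, h1])

lemma circleCoord_toProjLine (v : {v : Fin 2 → ℝ // v ≠ 0}) :
    circleCoord (toProjLine v) =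
      ((v.1 0 : ℂ) + v.1 1 * Complex.I) / ((v.1 0 : ℂ) - v.1 1 * Complex.I) := rfl

lemma continuous_circleCoord : Continuous circleCoord := by
  refine isOpenQuotientMap_toProjLine.isQuotientMap.continuous_iff.mpr ?_
  have hc : ∀ i, Continuous fun v : {v : Fin 2 → ℝ // v ≠ 0} => (v.1 i : ℂ) := fun i =>
    Complex.continuous_ofReal.comp ((continuous_apply i).comp continuous_subtype_val)
  exact ((hc 0).add ((hc 1).mul_const _)).div ((hc 0).sub ((hc 1).mul_const _)) coord_sub_ne_zero

instance : Fact (0 < Real.pi) := ⟨Real.pi_pos⟩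

/-- The line at angle `θ`. -/
noncomputable def lineAt (θ : ℝ) : ProjLine := toProjLine ⟨![Real.cos θ, Real.sin θ], by
  intro h
  have h0 := congrFun h 0
  have h1 := congrFun h 1
  simp at h0 h1
  simpa [h0, h1] using Real.cos_sq_add_sin_sq θ⟩

lemma lineAt_periodic : Function.Periodic lineAt Real.pi := fun θ => by
  rw [lineAt, lineAt, toProjLine_eq_iff]
  simp
  ring

/-- The parametrization of the projective line by the angle. -/
noncomputable def angleMap : AddCircle Real.pi → ProjLine := lineAt_periodic.lift

lemma angleMap_coe (θ : ℝ) : angleMap θ = lineAt θ := rfl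

lemma continuous_angleMap : Continuous angleMap := by
  refine Continuous.quotient_lift ?_ _
  exact isOpenQuotientMap_toProjLine.continuous.comp (Continuous.subtype_mk
    (continuous_pi fun i => by fin_cases i <;> simp <;> fun_prop) _)

/-- At angle θ the coordinate is exp(2iθ), the basic character of ℝ/πℤ. -/
lemma circleCoord_angleMap (x : AddCircle Real.pi) : circleCoord (angleMap x) = fourier 1 x := by
  induction x using QuotientAddGroup.induction_on with
  | H θ =>
    rw [angleMap_coe, lineAt, circleCoord_toProjLine, fourier_coe_apply]
    simp only [Matrix.cons_val_zero, Matrix.cons_val_one, Complex.ofReal_cos, Complex.ofReal_sin]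
    rw [Complex.cos_add_sin_I, ← neg_neg (Complex.sin θ), neg_mul, sub_neg_eq_add,
      ← Complex.sin_neg, ← Complex.cos_neg, Complex.cos_add_sin_I, ← Complex.exp_sub]
    congr 1
    have : (Real.pi : ℂ) ≠ 0 := by exact_mod_cast Real.pi_ne_zero
    field_simp
    push_cast
    ring

lemma bijective_angleMap : Function.Bijective angleMap := by
  constructor
  · intro x y h
    have := congrArg circleCoord h
    rw [circleCoord_angleMap, circleCoord_angleMap, fourier_one, fourier_one] at this
    exact AddCircle.injective_toCircle Real.pi_ne_zero (Subtype.ext this)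
  · intro p
    obtain ⟨v, rfl⟩ := isOpenQuotientMap_toProjLine.surjective p
    refine ⟨(Complex.arg ⟨v.1 0, v.1 1⟩ : ℝ), ?_⟩
    rw [angleMap_coe, lineAt, toProjLine_eq_iff]
    have h0 := Complex.norm_mul_cos_arg ⟨v.1 0, v.1 1⟩
    have h1 := Complex.norm_mul_sin_arg ⟨v.1 0, v.1 1⟩
    simp only at h0 h1
    simp only [Matrix.cons_val_zero, Matrix.cons_val_one]
    linear_combination Real.sin (Complex.arg ⟨v.1 0, v.1 1⟩) * h0 -
      Real.cos (Complex.arg ⟨v.1 0, v.1 1⟩) * h1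

instance : T2Space ProjLine := by
  refine T2Space.of_injective_continuous (f := circleCoord) (fun p q h => ?_)
    continuous_circleCoord
  obtain ⟨x, rfl⟩ := bijective_angleMap.2 p
  obtain ⟨y, rfl⟩ := bijective_angleMap.2 q
  rw [circleCoord_angleMap, circleCoord_angleMap, fourier_one, fourier_one] at h
  rw [AddCircle.injective_toCircle Real.pi_ne_zero (Subtype.ext h)]

/-- The projective line is a circle. -/
noncomputable def angleHomeo : AddCircle Real.pi ≃ₜ ProjLine :=
  Continuous.homeoOfEquivCompactToT2 (f := Equiv.ofBijective angleMap bijective_angleMap)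
    continuous_angleMap

lemma angleHomeo_apply (x : AddCircle Real.pi) : angleHomeo x = angleMap x := rfl

lemma fourier_one_angleHomeo_symm (p : ProjLine) :
    fourier 1 (angleHomeo.symm p) = circleCoord p := by
  rw [← circleCoord_angleMap, ← angleHomeo_apply, Homeomorph.apply_symm_apply]

instance : CompactSpace ProjLine := angleHomeo.compactSpace

instance : TopologicalSpace.MetrizableSpace ProjLine :=
  angleHomeo.symm.isEmbedding.metrizableSpace

lemma exists_smul_eq_rotation (a : AddCircle Real.pi) :
    ∃ g : PSL(2, ℝ), ∀ x, g • angleMap x = angleMap (x + a) := by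
  induction a using QuotientAddGroup.induction_on with
  | H α =>
    let r : SL(2, ℝ) := ⟨!![Real.cos α, -Real.sin α; Real.sin α, Real.cos α], by
      rw [Matrix.det_fin_two_of]
      linarith [Real.cos_sq_add_sin_sq α]⟩
    refine ⟨QuotientGroup.mk r, fun x => ?_⟩
    induction x using QuotientAddGroup.induction_on with
    | H θ =>
      rw [← QuotientAddGroup.mk_add, angleMap_coe, angleMap_coe, lineAt, smul_toProjLine, lineAt]
      congr 1
      refine Subtype.ext ?_
      simp only [SL_smul_eq, Real.cos_add, Real.sin_add]
      ext i
      fin_cases i <;> simp [r] <;> ring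

lemma one_add_smul_circleCoord_ne_zero {τ : ℝ} (hτ : |τ| < 1) (p : ProjLine) :
    1 + (τ : ℂ) * circleCoord p ≠ 0 := by
  intro h
  have h1 : ‖(τ : ℂ) * circleCoord p‖ = 1 := by
    rw [eq_neg_of_add_eq_zero_right h]
    simp
  obtain ⟨x, rfl⟩ := bijective_angleMap.2 p
  rw [circleCoord_angleMap, fourier_one, norm_mul, Circle.norm_coe, mul_one] at h1
  simp at h1
  linarith

/-- In the circle coordinate, diag(a, a⁻¹) is this Möbius map with τ = (a² - 1)/(a² + 1); solving
for a² gives (1 + τ)/(1 - τ). -/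
lemma exists_smul_eq_boost {τ : ℝ} (hτ : |τ| < 1) : ∃ g : PSL(2, ℝ), ∀ p : ProjLine,
    circleCoord (g • p) = (circleCoord p + τ) / (1 + τ * circleCoord p) := by
  obtain ⟨h1, h2⟩ := abs_lt.mp hτ
  have hpos : 0 < (1 + τ) / (1 - τ) := div_pos (by linarith) (by linarith)
  set a := √((1 + τ) / (1 - τ)) with ha
  have ha0 : a ≠ 0 := (Real.sqrt_pos.mpr hpos).ne'
  have ha2 : a ^ 2 * (1 - τ) = 1 + τ := by
    rw [ha, Real.sq_sqrt hpos.le]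
    field_simp [show 1 - τ ≠ 0 by linarith]
  refine ⟨QuotientGroup.mk (upperTri a ha0 0), fun p => ?_⟩
  have hden := one_add_smul_circleCoord_ne_zero hτ p
  obtain ⟨v, rfl⟩ := isOpenQuotientMap_toProjLine.surjective p
  have hd := coord_sub_ne_zero v
  have hd' := coord_sub_ne_zero ⟨upperTri a ha0 0 • v.1, (smul_ne_zero_iff_ne _).mpr v.2⟩
  rw [smul_toProjLine, circleCoord_toProjLine]
  rw [circleCoord_toProjLine] at hden ⊢
  rw [div_eq_div_iff hd' hden]
  simp only [SL_smul_eq]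
  simp [upperTri]
  have ha0' : (a : ℂ) ≠ 0 := by exact_mod_cast ha0
  have ha2' : (a : ℂ) ^ 2 * (1 - τ) = 1 + τ := by exact_mod_cast ha2
  field_simp
  linear_combination (-2 * (v.1 0 : ℂ) * v.1 1 * Complex.I) * ha2'

end ProjectiveLine

/-! ### Closed invariant subspaces of C(ℙ¹) -/

section InvariantSubspaces

/-- The function on the projective line with the real part of `F` as its expression in the
angle coordinate. -/
noncomputable def rePart : C(AddCircle Real.pi, ℂ) →L[ℝ] C(ProjLine, ℝ) where
  toFun F := ⟨fun p => (F (angleHomeo.symm p)).re, by fun_prop⟩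
  map_add' _ _ := by ext; simp
  map_smul' _ _ := by ext; simp
  cont := (ContinuousMap.continuous_postcomp ⟨Complex.re, Complex.continuous_re⟩).comp
    (ContinuousMap.continuous_precomp (angleHomeo.symm : C(ProjLine, AddCircle Real.pi)))

/-- The function on the projective line with the imaginary part of `F` as its expression in the
angle coordinate. -/
noncomputable def imPart : C(AddCircle Real.pi, ℂ) →L[ℝ] C(ProjLine, ℝ) where
  toFun F := ⟨fun p => (F (angleHomeo.symm p)).im, by fun_prop⟩
  map_add' _ _ := by ext; simp
  map_smul' _ _ := by ext; simp
  cont := (ContinuousMap.continuous_postcomp ⟨Complex.im, Complex.continuous_im⟩).comp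
    (ContinuousMap.continuous_precomp (angleHomeo.symm : C(ProjLine, AddCircle Real.pi)))

@[simp] lemma rePart_apply (F : C(AddCircle Real.pi, ℂ)) (p : ProjLine) :
    rePart F p = (F (angleHomeo.symm p)).re := rfl

@[simp] lemma imPart_apply (F : C(AddCircle Real.pi, ℂ)) (p : ProjLine) :
    imPart F p = (F (angleHomeo.symm p)).im := rfl

/-- The complex functions with real and imaginary parts in `V`. -/
noncomputable def complexify (V : Submodule ℝ C(ProjLine, ℝ)) :
    Submodule ℂ C(AddCircle Real.pi, ℂ) where
  carrier := {F | rePart F ∈ V ∧ imPart F ∈ V}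
  add_mem' hF hG := by
    simp only [Set.mem_ofPred_eq, map_add] at *
    exact ⟨V.add_mem hF.1 hG.1, V.add_mem hF.2 hG.2⟩
  zero_mem' := by simp
  smul_mem' c F hF := by
    have h1 : rePart (c • F) = c.re • rePart F - c.im • imPart F := by ext; simp
    have h2 : imPart (c • F) = c.re • imPart F + c.im • rePart F := by ext; simp
    simp only [Set.mem_ofPred_eq, h1, h2] at *
    exact ⟨V.sub_mem (V.smul_mem _ hF.1) (V.smul_mem _ hF.2),
      V.add_mem (V.smul_mem _ hF.2) (V.smul_mem _ hF.1)⟩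

lemma mem_complexify {V : Submodule ℝ C(ProjLine, ℝ)} {F : C(AddCircle Real.pi, ℂ)} :
    F ∈ complexify V ↔ rePart F ∈ V ∧ imPart F ∈ V := Iff.rfl

/-- `C(ℙ¹) / ℝ` has no proper closed `PSL(2, ℝ)`-invariant subspaces. -/
theorem submodule_eq_top {V : Submodule ℝ C(ProjLine, ℝ)}
    (hcl : IsClosed (V : Set C(ProjLine, ℝ)))
    (hinv : ∀ (g : PSL(2, ℝ)), ∀ f ∈ V, precompSMul ProjLine g f ∈ V)
    (hne : ∃ f ∈ V, ∃ p q, f p ≠ f q) : V = ⊤ := by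
  have hcomp : ∀ F ∈ complexify V, ∀ (F' : C(AddCircle Real.pi, ℂ)) (g : PSL(2, ℝ)),
      (∀ p, F' (angleHomeo.symm p) = F (angleHomeo.symm (g • p))) → F' ∈ complexify V := by
    intro F hF F' g h
    have h1 : rePart F' = precompSMul ProjLine g (rePart F) := by
      ext p
      exact congrArg Complex.re (h p)
    have h2 : imPart F' = precompSMul ProjLine g (imPart F) := by
      ext p
      exact congrArg Complex.im (h p)
    rw [mem_complexify, h1, h2]
    exact ⟨hinv g _ hF.1, hinv g _ hF.2⟩
  have hsymm : ∀ x, angleHomeo.symm (angleMap x) = x := angleHomeo.symm_apply_apply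
  have htop : complexify V = ⊤ := by
    refine fourier_submodule_eq_top ?_ ?_ ?_ ?_ ?_
    · exact (hcl.preimage rePart.continuous).inter (hcl.preimage imPart.continuous)
    · intro F hF a
      obtain ⟨g, hg⟩ := exists_smul_eq_rotation a
      refine hcomp F hF _ g fun p => ?_
      obtain ⟨x, rfl⟩ := bijective_angleMap.2 p
      rw [hg, hsymm, hsymm, translate_apply]
    · intro F hF
      have h1 : rePart (star F) = rePart F := by ext; simp
      have h2 : imPart (star F) = -imPart F := by ext; simp
      rw [mem_complexify, h1, h2]
      exact ⟨hF.1, V.neg_mem hF.2⟩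
    · intro n hn τ hτ
      obtain ⟨g, hg⟩ := exists_smul_eq_boost hτ
      refine hcomp _ hn _ g fun p => ?_
      have hpow : ∀ x : AddCircle Real.pi, (fourier n x : ℂ) = fourier 1 x ^ n := fun x => by
        simp [fourier_apply, AddCircle.toCircle_nsmul]
      -- Invertibility makes the `Ring.inverse` in `boost` a genuine pointwise reciprocal.
      have hu : IsUnit (1 + (τ : ℂ) • fourier 1 : C(AddCircle Real.pi, ℂ)) := by
        refine (ContinuousMap.isUnit_iff_forall_ne_zero _).mpr fun x => ?_
        have := one_add_smul_circleCoord_ne_zero hτ (angleMap x)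
        rwa [circleCoord_angleMap] at this
      have hx := congrArg (fun F : C(AddCircle Real.pi, ℂ) => F (angleHomeo.symm p))
        (Ring.inverse_mul_cancel _ hu)
      simp only [ContinuousMap.mul_apply, ContinuousMap.add_apply, ContinuousMap.smul_apply,
        ContinuousMap.one_apply, fourier_one_angleHomeo_symm, smul_eq_mul] at hx
      rw [hpow, fourier_one_angleHomeo_symm, hg, ContinuousMap.pow_apply, boost,
        ContinuousMap.mul_apply, ContinuousMap.add_apply, fourier_one_angleHomeo_symm,
        eq_div_of_mul_eq (one_add_smul_circleCoord_ne_zero hτ p) hx]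
      simp [div_eq_mul_inv]
    · obtain ⟨f, hf, p, q, hpq⟩ := hne
      refine ⟨⟨fun x => (f (angleHomeo x) : ℂ), by fun_prop⟩, ⟨?_, ?_⟩, angleHomeo.symm p,
        angleHomeo.symm q, by simpa using hpq⟩
      · convert! hf
        ext
        simp
      · convert! V.zero_mem
  rw [eq_top_iff]
  intro f _
  have hF : (⟨fun x => (f (angleHomeo x) : ℂ), by fun_prop⟩ : C(AddCircle Real.pi, ℂ)) ∈
      complexify V := by
    rw [htop]
    trivial
  convert! hF.1
  ext
  simp

end InvariantSubspaces

/-! ### Strong proximality, irreducibility and the universal property -/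

section Proximality

lemma tendsto_probMeasures_iff {X ι : Type*} [TopologicalSpace X] [MeasurableSpace X]
    [BorelSpace X] {l : Filter ι} {m : ι → probMeasures X} {m₀ : probMeasures X} :
    Tendsto m l (𝓝 m₀) ↔ ∀ f : C(X, ℝ), Tendsto (fun i => (m i : WeakDual ℝ C(X, ℝ)) f) l
      (𝓝 ((m₀ : WeakDual ℝ C(X, ℝ)) f)) := by
  rw [tendsto_subtype_rng]
  exact tendsto_iff_forall_eval_tendsto_topDualPairing

lemma pointMass_injective {X : Type*} [TopologicalSpace X] [MeasurableSpace X] [BorelSpace X]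
    [TopologicalSpace.MetrizableSpace X] :
    Function.Injective (pointMass : X → probMeasures X) := by
  let := TopologicalSpace.metrizableSpaceMetric X
  intro x y h
  have := congrArg (fun m : probMeasures X => (m : WeakDual ℝ C(X, ℝ))
    ⟨fun z => dist z y, by fun_prop⟩) h
  simpa using this

instance : Uncountable ProjLine := by
  have : Function.Injective fun t : ℝ => toProjLine ⟨![t, 1], by simp⟩ := fun s t h => by
    rw [toProjLine_eq_iff] at h
    simpa using h
  exact this.uncountable

/-- There is a sequence in `PSL(2, ℝ)` which moves all lines but one to a fixed line. -/
lemma exists_contraction (p : ProjLine) : ∃ (g : ℕ → PSL(2, ℝ)) (q : ProjLine),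
    ∀ x, x ≠ p → Tendsto (fun n => g n • x) atTop (𝓝 q) := by
  obtain ⟨h, rfl⟩ := exists_smul_horizontal p
  have hc : ∀ n : ℕ, ((n : ℝ) + 1)⁻¹ ≠ 0 := fun n => by positivity
  -- `h⁻¹` takes the exceptional line to the horizontal one; diag(c, c⁻¹) with c = 1/(n + 1) then
  -- pushes all other lines to the vertical one.
  refine ⟨fun n => QuotientGroup.mk (upperTri _ (hc n) 0) * h⁻¹, toProjLine ⟨![0, 1], by simp⟩,
    fun x hx => ?_⟩
  obtain ⟨v, hv⟩ := isOpenQuotientMap_toProjLine.surjective (h⁻¹ • x)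
  have hv1 : v.1 1 ≠ 0 := by
    intro h1
    refine hx ?_
    rw [← inv_smul_eq_iff, ← hv, horizontal, toProjLine_eq_iff]
    simp [h1]
  have hlim : Tendsto (fun n : ℕ => (⟨![((n : ℝ) + 1)⁻¹ ^ 2 * v.1 0 / v.1 1, 1], by simp⟩ :
      {v : Fin 2 → ℝ // v ≠ 0})) atTop (𝓝 ⟨![0, 1], by simp⟩) := by
    rw [tendsto_subtype_rng, tendsto_pi_nhds]
    intro i
    fin_cases i
    · have := ((tendsto_one_div_add_atTop_nhds_zero_nat (𝕜 := ℝ)).pow 2).mul_const (v.1 0 / v.1 1)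
      simpa [mul_div_assoc] using this
    · simp
  convert! (isOpenQuotientMap_toProjLine.continuous.tendsto _).comp hlim using 2 with n
  rw [mul_smul, ← hv, smul_toProjLine, Function.comp_apply, toProjLine_eq_iff]
  simp only [SL_smul_eq]
  simp [upperTri]
  field_simp

/-- Minimality is transitivity. A probability measure has countably many atoms and ℙ¹ is
uncountable, so some point is null; contracting away from it concentrates the measure, by dominated
convergence. -/
theorem isMinimalStronglyProximal_projLine : IsMinimalStronglyProximal PSL(2, ℝ) ProjLine where
  nonempty := ⟨horizontal⟩
  compact := inferInstance
  metrizable := inferInstance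
  minimal := ⟨fun p => by
    refine Function.Surjective.denseRange fun q => ?_
    obtain ⟨g, rfl⟩ := exists_smul_horizontal p
    obtain ⟨h, rfl⟩ := exists_smul_horizontal q
    exact ⟨h * g⁻¹, by simp [mul_smul]⟩⟩
  strongly_proximal m := by
    obtain ⟨_, μ, hμ⟩ := m
    obtain ⟨p, hp⟩ : ∃ p : ProjLine, (μ : Measure ProjLine) {p} = 0 := by
      by_contra! h
      have hcount := Measure.countable_meas_pos_of_disjoint_iUnion (μ := (μ : Measure ProjLine))
        (As := fun p : ProjLine => {p}) (fun p => measurableSet_singleton p)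
        (fun p q hpq => Set.disjoint_singleton.mpr hpq)
      have : {p : ProjLine | 0 < (μ : Measure ProjLine) {p}} = Set.univ :=
        Set.eq_univ_of_forall fun p => pos_iff_ne_zero.mpr (h p)
      rw [this] at hcount
      exact Set.not_countable_univ hcount
    obtain ⟨g, q, hg⟩ := exists_contraction p
    refine ⟨g, q, tendsto_probMeasures_iff.mpr fun f => ?_⟩
    simp only [smul_apply, hμ, pointMass_apply]
    have hlim : Tendsto (fun n => ∫ x, precompSMul ProjLine (g n) f x ∂(μ : Measure ProjLine))
        atTop (𝓝 (∫ _, f q ∂(μ : Measure ProjLine))) := by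
      refine tendsto_integral_of_dominated_convergence (fun _ => ‖f‖)
        (fun n => (precompSMul ProjLine (g n) f).continuous.measurable.aestronglyMeasurable)
        (integrable_const _) (fun n => Eventually.of_forall fun x => f.norm_coe_le_norm _) ?_
      have hae : ∀ᵐ x ∂(μ : Measure ProjLine), x ≠ p := by
        rw [ae_iff]
        simpa using hp
      filter_upwards [hae] with x hx
      exact (f.continuous.tendsto q).comp (hg x hx)
    simpa using hlim

/-- Strong proximality puts one point mass in a closed invariant set, minimality all of them, and
convexity then everything. -/
theorem isIrreducible_probMeasures {G X : Type*} [Group G] [TopologicalSpace G]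
    [TopologicalSpace X] [MeasurableSpace X] [BorelSpace X] [MulAction G X] [ContinuousSMul G X]
    (hX : IsMinimalStronglyProximal G X) : IsIrreducible G (probMeasures X) := by
  have := hX.compact
  have := hX.metrizable
  have := hX.minimal
  intro S ⟨m, hm⟩ hcl hconv hinv
  refine eq_univ_of_pointMass_mem hcl hconv ?_
  obtain ⟨g, x, hg⟩ := hX.strongly_proximal m
  have hx : pointMass x ∈ S := hcl.mem_of_tendsto hg (Eventually.of_forall fun n => hinv _ _ hm)
  have hcont : Continuous (pointMass : X → probMeasures X) :=
    continuous_iff_continuousAt.mpr fun y => tendsto_probMeasures_iff.mpr fun f =>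
      f.continuous.tendsto y
  intro y
  have hdense := (MulAction.dense_orbit G x).closure_eq
  have : closure (MulAction.orbit G x) ⊆ pointMass ⁻¹' S :=
    closure_minimal (by rintro _ ⟨g, rfl⟩; exact hinv g _ hx) (hcl.preimage hcont)
  exact this (hdense ▸ Set.mem_univ y)

/-- The projective line has every minimal strongly proximal system as a factor. -/
theorem exists_factor {Y : Type*} [TopologicalSpace Y] [MeasurableSpace Y] [BorelSpace Y]
    [MulAction PSL(2, ℝ) Y] [ContinuousSMul PSL(2, ℝ) Y]
    (hY : IsMinimalStronglyProximal PSL(2, ℝ) Y) :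
    ∃ π : ProjLine → Y, Continuous π ∧ Function.Surjective π ∧
      ∀ (g : PSL(2, ℝ)) (p : ProjLine), π (g • p) = g • π p := by
  have := hY.nonempty
  have := hY.compact
  have := hY.metrizable
  have := hY.minimal
  have hM : IsAffineSystem PSL(2, ℝ) (probMeasures Y) := isAffineSystem_probMeasures
  have := hM.continuous_smul
  obtain ⟨m, hm⟩ := exists_fixed_upperTri hM
  obtain ⟨φ, hφ, hφe, hφm⟩ := exists_equivariant_of_fixed m hm
  obtain ⟨g, y, hg⟩ := hY.strongly_proximal m
  obtain ⟨p, hp⟩ : pointMass y ∈ Set.range φ :=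
    (isCompact_range hφ).isClosed.mem_of_tendsto hg
      (Eventually.of_forall fun n => ⟨g n • horizontal, by rw [hφe, hφm]⟩)
  -- The image of `φ` is the orbit of `m`, so `m` is itself a point mass, and its support is fixed
  -- by the upper triangular group.
  obtain ⟨h, rfl⟩ := exists_smul_horizontal p
  rw [hφe, hφm, ← eq_inv_smul_iff, smul_pointMass] at hp
  obtain ⟨π, hπ, hπe, hπy⟩ := exists_equivariant_of_fixed (h⁻¹ • y) fun a ha b =>
    pointMass_injective (by rw [← smul_pointMass, ← hp]; exact hm a ha b)
  refine ⟨π, hπ, Set.range_eq_univ.mp ?_, hπe⟩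
  rw [← (isCompact_range hπ).isClosed.closure_eq]
  refine ((MulAction.dense_orbit PSL(2, ℝ) (h⁻¹ • y)).mono ?_).closure_eq
  rintro _ ⟨k, rfl⟩
  exact ⟨k • horizontal, by rw [hπe, hπy]⟩

end Proximality

/-! ### Functoriality of M(X) -/

section PushForward

variable {G X Y : Type*} [Group G] [TopologicalSpace X] [MeasurableSpace X] [BorelSpace X]
  [MulAction G X] [ContinuousConstSMul G X] [TopologicalSpace Y] [MeasurableSpace Y] [BorelSpace Y]
  [MulAction G Y] [ContinuousConstSMul G Y]

/-- The push-forward of probability measures under a continuous map. -/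
def pushForward (π : C(X, Y)) (m : probMeasures X) : probMeasures Y :=
  ⟨ContinuousLinearMap.comp (m : WeakDual ℝ C(X, ℝ))
    (⟨⟨⟨fun f => f.comp π, fun _ _ => rfl⟩, fun _ _ => rfl⟩, ContinuousMap.continuous_precomp π⟩ :
      C(Y, ℝ) →L[ℝ] C(X, ℝ)), by
    obtain ⟨_, μ, hμ⟩ := m
    refine ⟨μ.map π.continuous.measurable.aemeasurable, fun f => ?_⟩
    rw [ProbabilityMeasure.toMeasure_map, integral_map π.continuous.measurable.aemeasurable
      f.continuous.measurable.aestronglyMeasurable]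
    exact hμ (f.comp π)⟩

lemma continuous_pushForward (π : C(X, Y)) : Continuous (pushForward π) := by
  refine Continuous.subtype_mk (WeakDual.continuous_of_continuous_eval fun f => ?_) _
  exact (WeakDual.eval_continuous (f.comp π)).comp continuous_subtype_val

theorem affinelyIsomorphic_probMeasures (Φ : X ≃ₜ Y) (hΦ : ∀ (g : G) x, Φ (g • x) = g • Φ x) :
    AffinelyIsomorphic G (probMeasures X) (probMeasures Y) := by
  refine ⟨⟨⟨pushForward Φ, pushForward Φ.symm, fun m => ?_, fun m => ?_⟩,
    continuous_pushForward _, continuous_pushForward _⟩, fun g m => ?_, ?_⟩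
  · refine Subtype.ext (ContinuousLinearMap.ext fun f => ?_)
    change (m : WeakDual ℝ C(X, ℝ)) _ = (m : WeakDual ℝ C(X, ℝ)) f
    congr 1
    ext x
    exact congrArg f (Φ.symm_apply_apply x)
  · refine Subtype.ext (ContinuousLinearMap.ext fun f => ?_)
    change (m : WeakDual ℝ C(Y, ℝ)) _ = (m : WeakDual ℝ C(Y, ℝ)) f
    congr 1
    ext x
    exact congrArg f (Φ.apply_symm_apply x)
  · refine Subtype.ext (ContinuousLinearMap.ext fun f => ?_)
    change (m : WeakDual ℝ C(X, ℝ)) _ = (m : WeakDual ℝ C(X, ℝ)) _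
    congr 1
    ext x
    exact congrArg f (hΦ g x)
  · intro x y z a b _ _ _ h
    refine ContinuousLinearMap.ext fun f => ?_
    exact congrArg (fun θ : WeakDual ℝ C(X, ℝ) => θ (f.comp (Φ : C(X, Y)))) h

end PushForward

/-! ### Continuous affine functions -/

section AffineFunctions

variable {E : Type*} [AddCommGroup E] [Module ℝ E] [TopologicalSpace E] {Q : Set E}

/-- `a` preserves convex combinations. -/
def IsAffineFun (a : Q → ℝ) : Prop :=
  ∀ (x y z : Q) (s t : ℝ), 0 ≤ s → 0 ≤ t → s + t = 1 →
    (z : E) = s • (x : E) + t • (y : E) → a z = s * a x + t * a y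

variable (Q) in
/-- The continuous affine functions on `Q`. -/
def affineFunctions : Submodule ℝ C(Q, ℝ) where
  carrier := {a | IsAffineFun a}
  add_mem' {a b} ha hb x y z s t hs ht hst h := by
    simp only [ContinuousMap.add_apply, ha x y z s t hs ht hst h, hb x y z s t hs ht hst h]
    ring
  zero_mem' _ _ _ _ _ _ _ _ _ := by simp
  smul_mem' c a ha x y z s t hs ht hst h := by
    simp only [ContinuousMap.smul_apply, ha x y z s t hs ht hst h, smul_eq_mul]
    ring

lemma IsAffineSystem.comp_smul_mem {G : Type*} [Group G] [TopologicalSpace G] [MulAction G Q]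
    [ContinuousConstSMul G Q] (hQ : IsAffineSystem G Q) (g : G) {a : C(Q, ℝ)}
    (ha : a ∈ affineFunctions Q) : precompSMul Q g a ∈ affineFunctions Q :=
  fun x y z s t hs ht hst h =>
    ha (g • x) (g • y) (g • z) s t hs ht hst (hQ.affine g x y z s t hs ht hst h)

lemma eq_of_affineFunctions [IsTopologicalAddGroup E] [ContinuousSMul ℝ E]
    [LocallyConvexSpace ℝ E] [T2Space E] {x y : Q} (h : ∀ a ∈ affineFunctions Q, a x = a y) :
    x = y := by
  by_contra hne
  obtain ⟨l, hl⟩ := geometric_hahn_banach_point_point (E := E) (x := (x : E)) (y := (y : E))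
    (fun h => hne (Subtype.ext h))
  refine hl.ne (h ⟨fun z => l z, l.continuous.comp continuous_subtype_val⟩ ?_)
  intro u v w s t _ _ _ hw
  change l w = s * l u + t * l v
  rw [hw]
  simp

/-- `x` is the barycenter of the image of `m` under `φ`. -/
def IsBarycenter {X : Type*} [TopologicalSpace X] [MeasurableSpace X] [BorelSpace X] (φ : C(X, Q))
    (p : probMeasures X × Q) : Prop :=
  ∀ a ∈ affineFunctions Q, a p.2 = (p.1 : WeakDual ℝ C(X, ℝ)) (a.comp φ)

end AffineFunctions

/-! ### The barycenter relation between M(X) and Q -/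

section Barycenters

variable {E : Type*} [AddCommGroup E] [Module ℝ E] [TopologicalSpace E] {Q : Set E}
  {X : Type*} [TopologicalSpace X] [MeasurableSpace X] [BorelSpace X] {φ : C(X, Q)}

lemma isClosed_isBarycenter : IsClosed {p : probMeasures X × Q | IsBarycenter φ p} := by
  simp only [IsBarycenter, Set.ofPred_forall]
  exact isClosed_iInter fun a => isClosed_iInter fun _ =>
    isClosed_eq (a.continuous.comp continuous_snd)
      ((WeakDual.eval_continuous _).comp (continuous_subtype_val.comp continuous_fst))

lemma IsBarycenter.combination {m m' m'' : probMeasures X} {x x' x'' : Q}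
    (h : IsBarycenter φ (m, x)) (h' : IsBarycenter φ (m', x')) {s t : ℝ} (hs : 0 ≤ s) (ht : 0 ≤ t)
    (hst : s + t = 1) (hm : (m'' : WeakDual ℝ C(X, ℝ)) = s • (m : WeakDual ℝ C(X, ℝ)) + t • m'.1)
    (hx : (x'' : E) = s • (x : E) + t • (x' : E)) : IsBarycenter φ (m'', x'') := fun a ha => by
  have h1 := h a ha
  have h2 := h' a ha
  simp only at h1 h2 ⊢
  rw [ha x x' x'' s t hs ht hst hx, h1, h2, hm]
  rfl

lemma isBarycenter_pointMass (p : X) : IsBarycenter φ (pointMass p, φ p) := fun _ _ => rfl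

lemma IsBarycenter.smul {G : Type*} [Group G] [TopologicalSpace G] [MulAction G Q]
    [ContinuousConstSMul G Q] [MulAction G X] [ContinuousConstSMul G X] (hQ : IsAffineSystem G Q)
    (hφ : ∀ (g : G) p, φ (g • p) = g • φ p) {m : probMeasures X} {x : Q}
    (h : IsBarycenter φ (m, x)) (g : G) : IsBarycenter φ (g • m, g • x) := fun a ha => by
  refine (h _ (hQ.comp_smul_mem g ha)).trans ?_
  change (m : WeakDual ℝ C(X, ℝ)) _ = (m : WeakDual ℝ C(X, ℝ)) _
  congr 1
  ext p
  exact congrArg a (hφ g p).symm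

/-- The relation is closed and convex and `Q` is compact, so its projection to M(X) is closed and
convex; it contains the point masses. -/
lemma exists_isBarycenter [CompactSpace X] [T2Space X] (hc : IsCompact Q) (hQ : Convex ℝ Q)
    (m : probMeasures X) : ∃ x, IsBarycenter φ (m, x) := by
  have : CompactSpace Q := isCompact_iff_compactSpace.mp hc
  have : Prod.fst '' {p : probMeasures X × Q | IsBarycenter φ p} = Set.univ := by
    refine eq_univ_of_pointMass_mem (isClosedMap_fst_of_compactSpace _ isClosed_isBarycenter) ?_
      fun p => ⟨_, isBarycenter_pointMass p, rfl⟩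
    rintro _ ⟨_, ⟨⟨m, x⟩, h, rfl⟩, rfl⟩ _ ⟨_, ⟨⟨m', x'⟩, h', rfl⟩, rfl⟩ s t hs ht hst
    exact ⟨⟨_, convex_probMeasures m.2 m'.2 hs ht hst⟩,
      ⟨⟨_, ⟨_, hQ x.2 x'.2 hs ht hst⟩⟩, h.combination h' hs ht hst rfl rfl, rfl⟩, rfl⟩
  obtain ⟨⟨_, x⟩, h, rfl⟩ := this.symm ▸ Set.mem_univ m
  exact ⟨x, h⟩

/-- The other projection of the relation is a nonempty closed convex invariant subset of `Q`. -/
lemma exists_isBarycenter_of_isIrreducible {G : Type*} [Group G] [TopologicalSpace G]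
    [MulAction G Q] [ContinuousConstSMul G Q] [MulAction G X] [ContinuousConstSMul G X]
    [CompactSpace X] [T2Space X] [Nonempty X] (hQ : IsAffineSystem G Q) (hirr : IsIrreducible G Q)
    (hφ : ∀ (g : G) p, φ (g • p) = g • φ p) (x : Q) :
    ∃ m : probMeasures X, IsBarycenter φ (m, x) := by
  have : CompactSpace (probMeasures X) := isCompact_iff_compactSpace.mp isCompact_probMeasures
  have : Prod.snd '' {p : probMeasures X × Q | IsBarycenter φ p} = Set.univ := by
    refine hirr _ ⟨_, _, isBarycenter_pointMass (Classical.arbitrary X), rfl⟩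
      (isClosedMap_snd_of_compactSpace _ isClosed_isBarycenter) ?_ ?_
    · rintro _ ⟨_, ⟨⟨m, x⟩, h, rfl⟩, rfl⟩ _ ⟨_, ⟨⟨m', x'⟩, h', rfl⟩, rfl⟩ s t hs ht hst
      exact ⟨⟨_, hQ.convex x.2 x'.2 hs ht hst⟩,
        ⟨⟨⟨_, convex_probMeasures m.2 m'.2 hs ht hst⟩, _⟩,
          h.combination h' hs ht hst rfl rfl, rfl⟩, rfl⟩
    · rintro g _ ⟨⟨m, x⟩, h, rfl⟩
      exact ⟨(g • m, g • x), h.smul hQ hφ g, rfl⟩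
  obtain ⟨⟨m, _⟩, h, rfl⟩ := this.symm ▸ Set.mem_univ x
  exact ⟨m, h⟩

end Barycenters

/-! ### Classification of irreducible affine systems -/

section Classification

variable {E : Type*} [AddCommGroup E] [Module ℝ E] [TopologicalSpace E]
  [IsTopologicalAddGroup E] [ContinuousSMul ℝ E] [LocallyConvexSpace ℝ E] [T2Space E]
  {Q : Set E} [MulAction PSL(2, ℝ) Q]

/-- The affine functions on `Q` are dense in `C(ℙ¹)`. -/
lemma dense_affineFunctions [ContinuousConstSMul PSL(2, ℝ) Q] (hQ : IsAffineSystem PSL(2, ℝ) Q)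
    (hnt : Q.Nontrivial) (hirr : IsIrreducible PSL(2, ℝ) Q) {φ : C(ProjLine, Q)}
    (hφ : ∀ (g : PSL(2, ℝ)) p, φ (g • p) = g • φ p) :
    Dense {f : C(ProjLine, ℝ) | ∃ a ∈ affineFunctions Q, a.comp φ = f} := by
  let L : C(Q, ℝ) →ₗ[ℝ] C(ProjLine, ℝ) := ⟨⟨fun a => a.comp φ, fun _ _ => rfl⟩, fun _ _ => rfl⟩
  suffices h : ((affineFunctions Q).map L).topologicalClosure = ⊤ from
    Submodule.dense_iff_topologicalClosure_eq_top.mpr h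
  refine submodule_eq_top (Submodule.isClosed_topologicalClosure _) (fun g f hf => ?_) ?_
  · refine map_mem_closure (precompSMul ProjLine g).continuous hf ?_
    rintro _ ⟨a, ha, rfl⟩
    refine ⟨precompSMul Q g a, hQ.comp_smul_mem g ha, ?_⟩
    ext p
    exact congrArg a (hφ g p).symm
  · by_contra! hcon
    -- Affine functions separate points, so `φ` would be constant and its value a fixed point, which
    -- a nontrivial irreducible system cannot have.
    have hconst : ∀ p q, φ p = φ q := fun p q => eq_of_affineFunctions fun a ha =>
      hcon (a.comp φ) (Submodule.le_topologicalClosure _ ⟨a, ha, rfl⟩) p q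
    have huniv := hirr {φ horizontal} (Set.singleton_nonempty _) isClosed_singleton
      (by simp) (by
        rintro g _ rfl
        rw [← hφ]
        exact hconst _ _)
    obtain ⟨x, hx, y, hy, hxy⟩ := hnt
    have h1 : (⟨x, hx⟩ : Q) ∈ ({φ horizontal} : Set Q) := huniv ▸ Set.mem_univ _
    have h2 : (⟨y, hy⟩ : Q) ∈ ({φ horizontal} : Set Q) := huniv ▸ Set.mem_univ _
    exact hxy (congrArg Subtype.val (h1.trans h2.symm))

theorem affinelyIsomorphic_of_isIrreducible (hQ : IsAffineSystem PSL(2, ℝ) Q)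
    (hnt : Q.Nontrivial) (hirr : IsIrreducible PSL(2, ℝ) Q) :
    AffinelyIsomorphic PSL(2, ℝ) (probMeasures ProjLine) Q := by
  have := hQ.continuous_smul
  have : CompactSpace Q := isCompact_iff_compactSpace.mp hQ.compact
  have : CompactSpace (probMeasures ProjLine) :=
    isCompact_iff_compactSpace.mp isCompact_probMeasures
  have : Nonempty ProjLine := ⟨horizontal⟩
  obtain ⟨z, hz⟩ := exists_fixed_upperTri hQ
  obtain ⟨φ₀, hφc, hφ, -⟩ := exists_equivariant_of_fixed z hz
  let φ : C(ProjLine, Q) := ⟨φ₀, hφc⟩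
  choose β hβ using exists_isBarycenter (X := ProjLine) (φ := φ) hQ.compact hQ.convex
  have huniq : ∀ {m x}, IsBarycenter φ (m, x) → β m = x := fun {m x} h =>
    eq_of_affineFunctions fun a ha => (hβ m a ha).trans (h a ha).symm
  have hinj : Function.Injective β := fun m m' h => by
    refine Subtype.ext (DFunLike.coe_injective ?_)
    refine Continuous.ext_on (dense_affineFunctions hQ hnt hirr (φ := φ) hφ)
      (map_continuous m.1) (map_continuous m'.1) ?_
    rintro _ ⟨a, ha, rfl⟩
    exact (hβ m a ha).symm.trans ((congrArg a h).trans (hβ m' a ha))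
  have hsurj : Function.Surjective β := fun x => by
    obtain ⟨m, hm⟩ := exists_isBarycenter_of_isIrreducible hQ hirr (φ := φ) hφ x
    exact ⟨m, huniq hm⟩
  -- Closed graph argument: the graph of `β` is the barycenter relation, and `Q` is compact.
  have hcont : Continuous β := by
    refine continuous_iff_isClosed.mpr fun C hC => ?_
    convert! isClosedMap_fst_of_compactSpace _
      ((isClosed_isBarycenter (φ := φ)).inter (hC.preimage continuous_snd)) using 1
    ext m
    constructor
    · exact fun h => ⟨(m, β m), ⟨hβ m, h⟩, rfl⟩
    · rintro ⟨⟨m, x⟩, ⟨h, hx⟩, rfl⟩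
      change β m ∈ C
      rwa [huniq h]
  refine ⟨Continuous.homeoOfEquivCompactToT2 (f := Equiv.ofBijective β ⟨hinj, hsurj⟩) hcont,
    fun g m => huniq ((hβ m).smul hQ hφ g), ?_⟩
  intro m m' m'' s t hs ht hst h
  exact congrArg Subtype.val (huniq (x := ⟨_, hQ.convex (β m).2 (β m').2 hs ht hst⟩)
    ((hβ m).combination (hβ m') hs ht hst h rfl))

end Classification

/-- A universal minimal strongly proximal system is isomorphic to the projective line. -/
theorem exists_homeomorph_of_universal {X : Type*} [TopologicalSpace X] [MeasurableSpace X]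
    [BorelSpace X] [MulAction PSL(2, ℝ) X] [ContinuousSMul PSL(2, ℝ) X]
    (hX : IsUniversalMinimalStronglyProximal.{_, 0, 0} PSL(2, ℝ) X) :
    ∃ Φ : ProjLine ≃ₜ X, ∀ (g : PSL(2, ℝ)) (p : ProjLine), Φ (g • p) = g • Φ p := by
  have := hX.1.metrizable
  obtain ⟨π, hπ, hsurj, hπe⟩ := exists_factor hX.1
  obtain ⟨ρ, -, -, hρe⟩ := hX.2 ProjLine isMinimalStronglyProximal_projLine
  -- Equivariance makes this line fixed by the upper triangular group; transitivity then gives ρ ∘ π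
  -- = id, so π is injective.
  have hfix : ρ (π horizontal) = horizontal := eq_horizontal_of_fixed fun a ha b => by
    rw [← hρe, ← hπe, upperTri_smul_horizontal]
  have hid : ∀ p, ρ (π p) = p := fun p => by
    obtain ⟨g, rfl⟩ := exists_smul_horizontal p
    rw [hπe, hρe, hfix]
  exact ⟨Continuous.homeoOfEquivCompactToT2
    (f := Equiv.ofBijective π ⟨Function.LeftInverse.injective hid, hsurj⟩) hπ, hπe⟩

end AffineDynamics

theorem corollary2p2 :
    -- the projective line is the universal minimal strongly proximal system of `PSL(2, ℝ)`
    AffineDynamics.IsUniversalMinimalStronglyProximal.{0, u, 0} PSL(2, ℝ)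
      AffineDynamics.ProjLine ∧
    -- and the only one, up to isomorphism
    (∀ (X : Type v) [TopologicalSpace X] [MeasurableSpace X] [BorelSpace X]
      [MulAction PSL(2, ℝ) X] [ContinuousSMul PSL(2, ℝ) X],
      AffineDynamics.IsUniversalMinimalStronglyProximal.{v, 0, 0} PSL(2, ℝ) X →
      (∃ Φ : AffineDynamics.ProjLine ≃ₜ X, ∀ (g : PSL(2, ℝ)) (p : AffineDynamics.ProjLine),
        Φ (g • p) = g • Φ p) ∧
      AffineDynamics.AffinelyIsomorphic PSL(2, ℝ)
        (AffineDynamics.probMeasures AffineDynamics.ProjLine) (AffineDynamics.probMeasures X)) ∧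
    -- `M(ℙ¹)` is a nontrivial irreducible affine system
    AffineDynamics.IsAffineSystem PSL(2, ℝ)
      (AffineDynamics.probMeasures AffineDynamics.ProjLine) ∧
    (AffineDynamics.probMeasures AffineDynamics.ProjLine).Nontrivial ∧
    AffineDynamics.IsIrreducible PSL(2, ℝ)
      (AffineDynamics.probMeasures AffineDynamics.ProjLine) ∧
    -- and the only one, up to isomorphism
    ∀ (E : Type w) [AddCommGroup E] [Module ℝ E] [TopologicalSpace E]
      [IsTopologicalAddGroup E] [ContinuousSMul ℝ E] [LocallyConvexSpace ℝ E] [T2Space E]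
      (Q : Set E) [MulAction PSL(2, ℝ) Q],
      AffineDynamics.IsAffineSystem PSL(2, ℝ) Q → Q.Nontrivial →
      AffineDynamics.IsIrreducible PSL(2, ℝ) Q →
      AffineDynamics.AffinelyIsomorphic PSL(2, ℝ)
        (AffineDynamics.probMeasures AffineDynamics.ProjLine) Q := by
  have hP := AffineDynamics.isMinimalStronglyProximal_projLine
  refine ⟨⟨hP, fun Y _ _ _ _ _ hY => AffineDynamics.exists_factor hY⟩, fun X _ _ _ _ _ hX => ?_,
    ?_, ?_, AffineDynamics.isIrreducible_probMeasures hP, ?_⟩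
  · obtain ⟨Φ, hΦ⟩ := AffineDynamics.exists_homeomorph_of_universal hX
    exact ⟨⟨Φ, hΦ⟩, AffineDynamics.affinelyIsomorphic_probMeasures Φ hΦ⟩
  · have := hP.nonempty
    exact AffineDynamics.isAffineSystem_probMeasures
  · obtain ⟨p, q, hpq⟩ := exists_pair_ne AffineDynamics.ProjLine
    exact ⟨_, (AffineDynamics.pointMass p).2, _, (AffineDynamics.pointMass q).2,
      fun h => hpq (AffineDynamics.pointMass_injective (Subtype.ext h))⟩
  · intro E _ _ _ _ _ _ _ Q _ hQ hnt hirr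
    exact AffineDynamics.affinelyIsomorphic_of_isIrreducible hQ hnt hirr
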